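/- Let $\mathbb K=\mathbb R$ or $\mathbb K=\mathbb C$, let $n\ge 1$, and consider a linear system of order $n$ $$0=\mathbf y^{(n)}+B_1\,\mathbf y^{(n-1)}+\dots+B_n\,\mathbf y,\qquad \mathbf y=\mathbf y(x)\in\mathbb K^m, \tag{S}$$ where the $B_k$ are $m\times m$ matrices whose entries are smooth functions of $x$ on an open set $U\subseteq\mathbb K$ (smooth means $C^\infty$ if $\mathbb K=\mathbb R$ and holomorphic if $\mathbb K=\mathbb C$). An invertible point transformation is a smooth diffeomorphism $(x,\mathbf y)\mapsto(z,\mathbf w)$ between open subsets of $\mathbb K\times\mathbb K^m$; it transforms one system into another, around $x_0$, if, whenever it carries the graph of a smooth function $\mathbf y(x)$ locally to the graph of a smooth function $\mathbf w(z)$ (with $dz/dx\neq0$ along the curve), $\mathbf y$ is a local solution of the first system if and only if $\mathbf w$ is a local solution of the second, and at least one solution of the first system defined around $x_0$ is carried to a graph in this way at $x_0$. The system (S) belongs, around $x_0\in U$, to the canonical class if some invertible point transformation transforms it, around $x_0$, into the canonical form $\mathbf w^{(n)}=0$. For every $x_0\in U$ the following holds. The system (S) belongs to the canonical class around $x_0$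 if and only if it can be transformed, around $x_0$, by an invertible point transformation into a system of uncoupled iterative equations $$\Psi^n[y_i]=0,\qquad i=1,\dots,m, $$ where $\Psi=r\frac{d}{dx}+s$ is one and the same scalar operator for all $i$, $\Psi^n$ is its $n$-fold iterate, and the source parameters $r$ and $s$ are smooth scalar functions on an open set, $r$ being nowhere zero there and $r$, $s$ being otherwise arbitrary. Moreover, (S) belongs to the canonical class around $x_0$ if and only if it can be transformed into such a system near $x_0$ by a linear change $\mathbf y=Q(x)\,\hat{\mathbf y}$ of the dependent variables alone, with $Q$ a smooth invertible $m\times m$ matrix. -/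

import Mathlib

open scoped ContDiff Topology

/-- `f` is smooth on some open neighbourhood of `x` (holomorphic there if `𝕜 = ℂ`). -/
def SmoothNear {𝕜 : Type*} [RCLike 𝕜] {F : Type*} [NormedAddCommGroup F] [NormedSpace 𝕜 F]
    (f : 𝕜 → F) (x : 𝕜) : Prop :=
  ∃ V : Set 𝕜, IsOpen V ∧ x ∈ V ∧ ContDiffOn 𝕜 ∞ f V

/-- An ordinary differential system for `m` unknown functions: the system reads `E.op y x = 0`,
the independent variable `x` ranging over the set `E.dom`. -/
structure ODESystem (𝕜 : Type*) (m : ℕ) where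
  dom : Set 𝕜
  op : (𝕜 → Fin m → 𝕜) → 𝕜 → Fin m → 𝕜

/-- `y` is a local solution around `x` of the system `E`. -/
def ODESystem.SolvedNear {𝕜 : Type*} [RCLike 𝕜] {m : ℕ} (E : ODESystem 𝕜 m)
    (y : 𝕜 → Fin m → 𝕜) (x : 𝕜) : Prop :=
  ∀ᶠ t in 𝓝 x, E.op y t = 0

/-- The linear systems
`0 = y⁽ⁿ⁾ + B₁ y⁽ⁿ⁻¹⁾ + ⋯ + B_k y⁽ⁿ⁻ᵏ⁾ + ⋯ + B_n y`, `y(x) ∈ 𝕜ᵐ`,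
where the entries of the `m × m` matrices `B_k = coeff k` (`1 ≤ k ≤ n`) are smooth functions
of `x` on the open set `dom`. -/
structure LinearSystem (𝕜 : Type*) [RCLike 𝕜] (n m : ℕ) where
  dom : Set 𝕜
  isOpen_dom : IsOpen dom
  coeff : ℕ → 𝕜 → Matrix (Fin m) (Fin m) 𝕜
  smooth_coeff : ∀ k ∈ Finset.Icc 1 n, ∀ i j : Fin m,
    ContDiffOn 𝕜 ∞ (fun x => coeff k x i j) dom

/-- A linear system as a differential system. -/
noncomputable def LinearSystem.toODE {𝕜 : Type*} [RCLike 𝕜] {n m : ℕ}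
    (S : LinearSystem 𝕜 n m) : ODESystem 𝕜 m where
  dom := S.dom
  op := fun y x => iteratedDeriv n y x +
    ∑ k ∈ Finset.Icc 1 n, (S.coeff k x).mulVec (iteratedDeriv (n - k) y x)

/-- The canonical form `y⁽ⁿ⁾ = 0` (for `m` unknown functions). -/
noncomputable def canonicalForm (𝕜 : Type*) [RCLike 𝕜] (n m : ℕ) : ODESystem 𝕜 m where
  dom := Set.univ
  op := fun y x => iteratedDeriv n y x

/-- A scalar first-order operator `Ψ = r d/dx + s` whose source parameters `r`, `s` are smooth
functions on an open set, `r` being invertible, i.e. nowhere zero, there. -/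
structure SourceOperator (𝕜 : Type*) [RCLike 𝕜] where
  dom : Set 𝕜
  isOpen_dom : IsOpen dom
  r : 𝕜 → 𝕜
  s : 𝕜 → 𝕜
  smooth_r : ContDiffOn 𝕜 ∞ r dom
  smooth_s : ContDiffOn 𝕜 ∞ s dom
  r_ne_zero : ∀ x ∈ dom, r x ≠ 0

/-- `Ψ[u] = r u' + s u`. -/
noncomputable def SourceOperator.apply {𝕜 : Type*} [RCLike 𝕜] (P : SourceOperator 𝕜)
    (u : 𝕜 → 𝕜) : 𝕜 → 𝕜 :=
  fun x => P.r x * deriv u x + P.s x * u x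

/-- The uncoupled system of iterative equations `Ψⁿ[yᵢ] = 0`, `i = 1, …, m`. -/
noncomputable def SourceOperator.iterativeSystem {𝕜 : Type*} [RCLike 𝕜] (P : SourceOperator 𝕜)
    (n m : ℕ) : ODESystem 𝕜 m where
  dom := P.dom
  op := fun y x i => (P.apply^[n] (fun t => y t i)) x

/-- An invertible point transformation `(x, y) ↦ (z, w)`: a smooth diffeomorphism between open
subsets of `𝕜 × 𝕜ᵐ`. It may mix the independent and the dependent variables. -/
structure PointTransformation (𝕜 : Type*) [RCLike 𝕜] (m : ℕ) where
  map : OpenPartialHomeomorph (𝕜 × (Fin m → 𝕜)) (𝕜 × (Fin m → 𝕜))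
  smooth_map : ContDiffOn 𝕜 ∞ map map.source
  smooth_symm : ContDiffOn 𝕜 ∞ map.symm map.target

/-- `Φ` carries the graph of the smooth function `y` around `x` to the graph of the smooth
function `w = w(z)`, the new independent variable `z = z(t)` being a regular parameter along the
curve `t ↦ Φ (t, y t)` at `t = x`. -/
def PointTransformation.CarriesGraph {𝕜 : Type*} [RCLike 𝕜] {m : ℕ}
    (Φ : PointTransformation 𝕜 m) (y w : 𝕜 → Fin m → 𝕜) (x : 𝕜) : Prop :=
  (x, y x) ∈ Φ.map.source ∧
  SmoothNear y x ∧
  SmoothNear w (Φ.map (x, y x)).1 ∧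
  deriv (fun t => (Φ.map (t, y t)).1) x ≠ 0 ∧
  ∀ᶠ t in 𝓝 x, (Φ.map (t, y t)).2 = w (Φ.map (t, y t)).1

/-- `Φ` transforms the system `E` (variables `x, y`) into the system `E'` (variables `z, w`):
whenever it carries the graph of `y` to the graph of `w`, the function `y` is a local solution
of `E` if and only if `w` is a local solution of `E'`. -/
def PointTransformation.Transforms {𝕜 : Type*} [RCLike 𝕜] {m : ℕ}
    (Φ : PointTransformation 𝕜 m) (E E' : ODESystem 𝕜 m) : Prop :=
  (∀ p ∈ Φ.map.source, p.1 ∈ E.dom) ∧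
  (∀ q ∈ Φ.map.target, q.1 ∈ E'.dom) ∧
  ∀ (y w : 𝕜 → Fin m → 𝕜) (x : 𝕜), Φ.CarriesGraph y w x →
    (E.SolvedNear y x ↔ E'.SolvedNear w (Φ.map (x, y x)).1)

/-- Around `x₀`, the system `E` can be transformed into `E'` by an invertible point
transformation. The last clause (some solution curve of `E` over `x₀` is actually carried to a
graph over the new independent variable) says that the transformation is not a vacuous one. -/
def ODESystem.TransformableAt {𝕜 : Type*} [RCLike 𝕜] {m : ℕ}
    (E E' : ODESystem 𝕜 m) (x₀ : 𝕜) : Prop :=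
  ∃ Φ : PointTransformation 𝕜 m, Φ.Transforms E E' ∧
    ∃ y w : 𝕜 → Fin m → 𝕜, Φ.CarriesGraph y w x₀ ∧ E.SolvedNear y x₀

/-- The canonical class: around `x₀`, the linear system is reducible by an invertible point
transformation to the canonical form `w⁽ⁿ⁾ = 0`. -/
def LinearSystem.InCanonicalClassAt {𝕜 : Type*} [RCLike 𝕜] {n m : ℕ}
    (S : LinearSystem 𝕜 n m) (x₀ : 𝕜) : Prop :=
  S.toODE.TransformableAt (canonicalForm 𝕜 n m) x₀

/-- On an open neighbourhood `V` of `x₀`, a linear change `y = Q(x) w` of the dependent variables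
alone, with `Q` a smooth invertible matrix, transforms `E` into `E'`. -/
def ODESystem.LinearlyTransformableAt {𝕜 : Type*} [RCLike 𝕜] {m : ℕ}
    (E E' : ODESystem 𝕜 m) (x₀ : 𝕜) : Prop :=
  ∃ (V : Set 𝕜) (Q : 𝕜 → Matrix (Fin m) (Fin m) 𝕜),
    IsOpen V ∧ x₀ ∈ V ∧ V ⊆ E.dom ∧ V ⊆ E'.dom ∧
    (∀ i j : Fin m, ContDiffOn 𝕜 ∞ (fun x => Q x i j) V) ∧
    (∀ x ∈ V, IsUnit (Q x)) ∧
    ∀ (w : 𝕜 → Fin m → 𝕜), ∀ x ∈ V, SmoothNear w x →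
      (E.SolvedNear (fun t => (Q t).mulVec (w t)) x ↔ E'.SolvedNear w x)

/-! The central point is that a nonlinear point transformation `Φ` of (S) to `w⁽ⁿ⁾ = 0` can be
replaced by its linearization along a single solution. Let `Φ` carry a solution `y` to `w`, and let
`z = f(x)` be the new independent variable along the graph of `y`. Perturb `y` to `y + ε η` with `η`
a solution; both systems are linear, so the first-order variation of `w` at fixed `z` again solves
`p⁽ⁿ⁾ = 0`. That variation is `M(x) η(x) = p(f(x))`, where `M = variation` depends linearly on `η`
and is invertible because the differential of `Φ` is. Thus `v = M η` is a solution of `p⁽ⁿ⁾ = 0`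
read in the variable `x`, where `d/dz = (1/f') d/dx`. Hence `Q = M⁻¹` takes (S) to `Ψⁿ[vᵢ] = 0` with
`r = 1/f'`, `s = 0`. The two halves are `solvedNear_variation` and, applying the inverse of `Φ`,
`exists_solvedNear_variation_eq`.

Conversely, every iterative system reduces to the canonical form by `z = ∫ dx/r` and `y = exp(-∫
s/r) w` (`exists_fibreChange`), and a linear change of variables is a point transformation. The
canonical form is itself iterative, with `Ψ = d/dx`. -/

open Filter

/-! ### Germs of smooth maps, local inverses, parameter derivatives and primitives over `ℝ` and `ℂ`.
-/

section Calculus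

variable {𝕜 : Type*} [RCLike 𝕜] {E F G : Type*} [NormedAddCommGroup E] [NormedSpace 𝕜 E]
  [NormedAddCommGroup F] [NormedSpace 𝕜 F] [NormedAddCommGroup G] [NormedSpace 𝕜 G]

/-- `f` is smooth at every point of a neighbourhood of `a`. -/
def SmoothGerm (𝕜 : Type*) [RCLike 𝕜] {E F : Type*} [NormedAddCommGroup E] [NormedSpace 𝕜 E]
    [NormedAddCommGroup F] [NormedSpace 𝕜 F] (f : E → F) (a : E) : Prop :=
  ∀ᶠ p in 𝓝 a, ContDiffAt 𝕜 ∞ f p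

theorem smoothNear_iff_smoothGerm {f : 𝕜 → F} {x : 𝕜} : SmoothNear f x ↔ SmoothGerm 𝕜 f x := by
  constructor
  · rintro ⟨V, hV, hx, h⟩
    filter_upwards [hV.mem_nhds hx] with t ht
    exact h.contDiffAt (hV.mem_nhds ht)
  · intro h
    obtain ⟨V, hV, hVo, hx⟩ := eventually_nhds_iff.1 h
    exact ⟨V, hVo, hx, fun t ht => (hV t ht).contDiffWithinAt⟩

theorem ContDiffOn.smoothGerm {f : E → F} {s : Set E} {a : E} (h : ContDiffOn 𝕜 ∞ f s)
    (hs : IsOpen s) (ha : a ∈ s) : SmoothGerm 𝕜 f a := by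
  filter_upwards [hs.mem_nhds ha] with p hp
  exact h.contDiffAt (hs.mem_nhds hp)

namespace SmoothGerm

variable {f g : E → F} {a : E}

theorem contDiffAt (h : SmoothGerm 𝕜 f a) : ContDiffAt 𝕜 ∞ f a := h.self_of_nhds

theorem differentiableAt (h : SmoothGerm 𝕜 f a) : DifferentiableAt 𝕜 f a :=
  h.contDiffAt.differentiableAt (by simp)

theorem continuousAt (h : SmoothGerm 𝕜 f a) : ContinuousAt f a := h.contDiffAt.continuousAt

theorem eventually (h : SmoothGerm 𝕜 f a) : ∀ᶠ p in 𝓝 a, SmoothGerm 𝕜 f p :=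
  eventually_eventually_nhds.2 h

theorem congr (h : SmoothGerm 𝕜 f a) (hg : g =ᶠ[𝓝 a] f) : SmoothGerm 𝕜 g a := by
  filter_upwards [h, hg.eventuallyEq_nhds] with p hp hgp
  exact hp.congr_of_eventuallyEq hgp

theorem comp {h : F → G} (hh : SmoothGerm 𝕜 h (f a)) (hf : SmoothGerm 𝕜 f a) :
    SmoothGerm 𝕜 (fun x => h (f x)) a := by
  filter_upwards [hf, hf.continuousAt.eventually hh] with p hp hhp
  exact hhp.comp p hp

theorem prodMk {h : E → G} (hf : SmoothGerm 𝕜 f a) (hh : SmoothGerm 𝕜 h a) :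
    SmoothGerm 𝕜 (fun x => (f x, h x)) a := by
  filter_upwards [hf, hh] with p hp hhp
  exact hp.prodMk hhp

theorem fst {f : E → F × G} (hf : SmoothGerm 𝕜 f a) : SmoothGerm 𝕜 (fun x => (f x).1) a :=
  hf.mono fun _ hp => hp.fst

theorem snd {f : E → F × G} (hf : SmoothGerm 𝕜 f a) : SmoothGerm 𝕜 (fun x => (f x).2) a :=
  hf.mono fun _ hp => hp.snd

theorem add (hf : SmoothGerm 𝕜 f a) (hg : SmoothGerm 𝕜 g a) :
    SmoothGerm 𝕜 (fun x => f x + g x) a := by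
  filter_upwards [hf, hg] with p hp hgp
  exact hp.add hgp

theorem smul {c : E → 𝕜} (hc : SmoothGerm 𝕜 c a) (hf : SmoothGerm 𝕜 f a) :
    SmoothGerm 𝕜 (fun x => c x • f x) a := by
  filter_upwards [hf, hc] with p hp hcp
  exact hcp.smul hp

theorem div {f g : E → 𝕜} (hf : SmoothGerm 𝕜 f a) (hg : SmoothGerm 𝕜 g a) (h0 : g a ≠ 0) :
    SmoothGerm 𝕜 (fun x => f x / g x) a := by
  filter_upwards [hf, hg, hg.continuousAt.eventually_ne h0] with p hp hgp h0p
  exact hp.div hgp h0p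

theorem fderiv (hf : SmoothGerm 𝕜 f a) : SmoothGerm 𝕜 (fderiv 𝕜 f) a :=
  hf.mono fun _ hp => hp.fderiv_right (by simp)

theorem clm_apply {L : E → F →L[𝕜] G} (hL : SmoothGerm 𝕜 L a) (hf : SmoothGerm 𝕜 f a) :
    SmoothGerm 𝕜 (fun x => L x (f x)) a := by
  filter_upwards [hL, hf] with p hp hfp
  exact hp.clm_apply hfp

theorem deriv {f : 𝕜 → F} {x : 𝕜} (hf : SmoothGerm 𝕜 f x) : SmoothGerm 𝕜 (deriv f) x :=
  hf.fderiv.clm_apply (Eventually.of_forall fun _ => contDiffAt_const (c := (1 : 𝕜)))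

theorem id : SmoothGerm 𝕜 (fun x : E => x) a := Eventually.of_forall fun _ => contDiffAt_id

theorem const {c : F} : SmoothGerm 𝕜 (fun _ : E => c) a :=
  Eventually.of_forall fun _ => contDiffAt_const

theorem apply {ι : Type*} [Fintype ι] {f : E → ι → F} (h : SmoothGerm 𝕜 f a) (i : ι) :
    SmoothGerm 𝕜 (fun x => f x i) a :=
  h.mono fun _ hp => contDiffAt_pi.1 hp i

/-- A smooth germ of a map of `𝕜 × 𝕜` restricted to a horizontal line is smooth. -/
theorem slice {u : 𝕜 × 𝕜 → F} {t e : 𝕜} (h : SmoothGerm 𝕜 u (t, e)) :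
    SmoothGerm 𝕜 (fun s => u (s, e)) t :=
  SmoothGerm.comp (f := fun s : 𝕜 => (s, e)) h (id.prodMk const)

end SmoothGerm

/-- Local inverse of a smooth map with invertible derivative. -/
theorem exists_smooth_local_inverse [CompleteSpace E] {g : E → E} {a : E}
    (hg : SmoothGerm 𝕜 g a) {g' : E ≃L[𝕜] E} (hg' : HasFDerivAt g (g' : E →L[𝕜] E) a)
    {U : Set E} (hU : U ∈ 𝓝 a) :
    ∃ e : OpenPartialHomeomorph E E, a ∈ e.source ∧ e.source ⊆ U ∧ (∀ x, e x = g x) ∧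
      ContDiffOn 𝕜 ∞ e e.source ∧ ContDiffOn 𝕜 ∞ e.symm e.target := by
  -- Invertible linear maps form an open set, so the derivative stays invertible near `a`; this
  -- makes the inverse smooth on its whole domain and not only at the image of `a`.
  have h0 : ∀ᶠ p in 𝓝 a, fderiv 𝕜 g p ∈ Set.range ((↑) : (E ≃L[𝕜] E) → E →L[𝕜] E) := by
    have h1 : ContinuousAt (fderiv 𝕜 g) a := hg.fderiv.continuousAt
    have h2 := ContinuousLinearEquiv.nhds g'
    rw [← hg'.fderiv] at h2
    exact h1.eventually h2
  obtain ⟨V, hV, hVo, haV⟩ := eventually_nhds_iff.1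
    (hg.and (h0.and (show ∀ᶠ p in 𝓝 a, p ∈ U from hU)))
  let e₀ := hg.contDiffAt.toOpenPartialHomeomorph g hg' (by simp)
  have he₀ : ∀ x, e₀ x = g x := fun _ => rfl
  have ha₀ : a ∈ e₀.source := hg.contDiffAt.mem_toOpenPartialHomeomorph_source hg' (by simp)
  refine ⟨e₀.restrOpen V hVo, ⟨ha₀, haV⟩, fun x hx => (hV x hx.2).2.2, he₀, ?_, ?_⟩
  · intro x hx
    exact (hV x hx.2).1.contDiffWithinAt
  · intro y hy
    have hs := (e₀.restrOpen V hVo).map_target hy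
    obtain ⟨L, hL⟩ := (hV _ hs.2).2.1
    have hd : DifferentiableAt 𝕜 g ((e₀.restrOpen V hVo).symm y) :=
      (hV _ hs.2).1.differentiableAt (by simp)
    refine ((e₀.restrOpen V hVo).contDiffAt_symm (f₀' := L) hy ?_ (hV _ hs.2).1).contDiffWithinAt
    rw [hL]
    exact hd.hasFDerivAt

/-- Partial derivative in the first variable. -/
noncomputable def partialFst (g : 𝕜 × 𝕜 → F) (p : 𝕜 × 𝕜) : F := fderiv 𝕜 g p (1, 0)

/-- Partial derivative in the second variable. -/
noncomputable def partialSnd (g : 𝕜 × 𝕜 → F) (p : 𝕜 × 𝕜) : F := fderiv 𝕜 g p (0, 1)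

theorem SmoothGerm.partialFst {g : 𝕜 × 𝕜 → F} {a : 𝕜 × 𝕜} (h : SmoothGerm 𝕜 g a) :
    SmoothGerm 𝕜 (partialFst g) a := h.fderiv.clm_apply const

theorem SmoothGerm.partialSnd {g : 𝕜 × 𝕜 → F} {a : 𝕜 × 𝕜} (h : SmoothGerm 𝕜 g a) :
    SmoothGerm 𝕜 (partialSnd g) a := h.fderiv.clm_apply const

theorem hasDerivAt_slice_fst {g : 𝕜 × 𝕜 → F} {t e : 𝕜} (h : DifferentiableAt 𝕜 g (t, e)) :
    HasDerivAt (fun s => g (s, e)) (partialFst g (t, e)) t :=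
  HasFDerivAt.comp_hasDerivAt (f := fun s : 𝕜 => (s, e)) t h.hasFDerivAt
    ((hasDerivAt_id t).prodMk (hasDerivAt_const t e))

theorem hasDerivAt_slice_snd {g : 𝕜 × 𝕜 → F} {t e : 𝕜} (h : DifferentiableAt 𝕜 g (t, e)) :
    HasDerivAt (fun s => g (t, s)) (partialSnd g (t, e)) e :=
  HasFDerivAt.comp_hasDerivAt (f := fun s : 𝕜 => (t, s)) e h.hasFDerivAt
    ((hasDerivAt_const e t).prodMk (hasDerivAt_id e))

theorem minSmoothness_two_le : minSmoothness 𝕜 2 ≤ (∞ : WithTop ℕ∞) := by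
  rw [minSmoothness_of_isRCLikeNormedField]
  exact WithTop.coe_le_coe.2 le_top

/-- Symmetry of the second derivative; it lets a parameter derivative pass through each
differentiation in the first variable. -/
theorem partialSnd_partialFst {g : 𝕜 × 𝕜 → F} {p : 𝕜 × 𝕜} (h : SmoothGerm 𝕜 g p) :
    partialSnd (partialFst g) p = partialFst (partialSnd g) p := by
  have hd : DifferentiableAt 𝕜 (fderiv 𝕜 g) p := h.fderiv.differentiableAt
  have key : ∀ v w : 𝕜 × 𝕜, fderiv 𝕜 (fun q => fderiv 𝕜 g q v) p w
      = fderiv 𝕜 (fderiv 𝕜 g) p w v := by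
    intro v w
    rw [fderiv_clm_apply hd (differentiableAt_const v)]
    simp
  have hs := h.contDiffAt.isSymmSndFDerivAt minSmoothness_two_le
  change fderiv 𝕜 (fun q => fderiv 𝕜 g q (1, 0)) p (0, 1)
    = fderiv 𝕜 (fun q => fderiv 𝕜 g q (0, 1)) p (1, 0)
  rw [key, key]
  exact hs _ _

/-- Differentiation with respect to a parameter commutes with iterated derivatives. -/
theorem hasDerivAt_iteratedDeriv_param (k : ℕ) {g : 𝕜 × 𝕜 → F} {x : 𝕜}
    (hg : SmoothGerm 𝕜 g (x, 0)) :
    ∀ᶠ t in 𝓝 x, HasDerivAt (fun e => iteratedDeriv k (fun s => g (s, e)) t)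
      (iteratedDeriv k (fun s => partialSnd g (s, 0)) t) 0 := by
  induction k generalizing g with
  | zero =>
    have h : ∀ᶠ t in 𝓝 x, ContDiffAt 𝕜 ∞ g (t, 0) :=
      (Eventually.curry_nhds hg).mono fun t ht => ht.self_of_nhds
    filter_upwards [h] with t ht
    simpa using hasDerivAt_slice_snd (ht.differentiableAt (by simp))
  | succ k ih =>
    -- One of the `k + 1` derivatives is absorbed into `g`, so that the induction hypothesis applies
    -- to `partialFst g`; `h2` then moves it back outside the parameter derivative.
    have h1 : ∀ᶠ p in 𝓝 (x, (0 : 𝕜)), iteratedDeriv (k + 1) (fun s => g (s, p.2)) p.1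
        = iteratedDeriv k (fun s => partialFst g (s, p.2)) p.1 := by
      filter_upwards [hg.eventually] with p hp
      rw [iteratedDeriv_succ']
      apply EventuallyEq.iteratedDeriv_eq
      have hc : Tendsto (fun s : 𝕜 => (s, p.2)) (𝓝 p.1) (𝓝 p) := by
        have : Continuous fun s : 𝕜 => (s, p.2) := by fun_prop
        exact this.tendsto p.1
      filter_upwards [hc.eventually hp] with s hs
      exact (hasDerivAt_slice_fst (hs.differentiableAt (by simp))).deriv
    have h2 : ∀ᶠ t in 𝓝 x, partialSnd (partialFst g) (t, 0) =
        deriv (fun s => partialSnd g (s, 0)) t := by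
      have h : ∀ᶠ t in 𝓝 x, SmoothGerm 𝕜 g (t, 0) :=
        (Eventually.curry_nhds hg.eventually).mono fun t ht => ht.self_of_nhds
      filter_upwards [h] with t ht
      rw [partialSnd_partialFst ht, (hasDerivAt_slice_fst ht.partialSnd.differentiableAt).deriv]
    filter_upwards [Eventually.curry_nhds h1, ih hg.partialFst, h2.eventually_nhds]
      with t ht1 ht2 ht3
    have h4 : iteratedDeriv k (fun s => partialSnd (partialFst g) (s, 0)) t
        = iteratedDeriv (k + 1) (fun s => partialSnd g (s, 0)) t := by
      rw [iteratedDeriv_succ']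
      exact EventuallyEq.iteratedDeriv_eq k ht3
    rw [← h4]
    exact ht2.congr_of_eventuallyEq ht1

theorem iteratedDeriv_apply {ι : Type*} [Fintype ι] (k : ℕ) {f : 𝕜 → ι → 𝕜} {x : 𝕜}
    (hf : SmoothGerm 𝕜 f x) (i : ι) :
    iteratedDeriv k f x i = iteratedDeriv k (fun t => f t i) x := by
  induction k generalizing f with
  | zero => simp
  | succ k ih =>
    rw [iteratedDeriv_succ', iteratedDeriv_succ', ih hf.deriv]
    apply EventuallyEq.iteratedDeriv_eq
    filter_upwards [hf] with t ht
    exact (hasDerivAt_pi.1 (ht.differentiableAt (by simp)).hasDerivAt i).deriv.symm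

theorem map_nhds_of_deriv_ne_zero {f : 𝕜 → 𝕜} {x : 𝕜} (hf : SmoothGerm 𝕜 f x)
    (h : deriv f x ≠ 0) : map f (𝓝 x) = 𝓝 (f x) :=
  (hf.contDiffAt.hasStrictDerivAt (by simp)).map_nhds_eq h

/-- A smooth function of one variable has a local primitive. -/
theorem exists_primitive {g : 𝕜 → 𝕜} {x₀ : 𝕜} (hg : SmoothGerm 𝕜 g x₀) :
    ∃ G : 𝕜 → 𝕜, ∀ᶠ x in 𝓝 x₀, HasDerivAt G (g x) x := by
  obtain ⟨δ, hδ, hV⟩ := Metric.nhds_basis_closedBall.eventually_iff.1 hg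
  have hgc : ContinuousOn g (Metric.closedBall x₀ δ) := fun x hx =>
    (hV hx).continuousAt.continuousWithinAt
  have hdc : ContinuousOn (deriv g) (Metric.closedBall x₀ δ) := fun x hx =>
    (((hV hx).fderiv_right (m := ∞) (by simp)).clm_apply
      (contDiffAt_const (c := (1 : 𝕜)))).continuousAt.continuousWithinAt
  have hgd : ∀ x ∈ Metric.closedBall x₀ δ, HasDerivAt g (deriv g x) x := fun x hx =>
    ((hV hx).differentiableAt (by simp)).hasDerivAt
  obtain ⟨C, hC⟩ := (isCompact_closedBall x₀ δ).exists_bound_of_continuousOn hgc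
  obtain ⟨D, hD⟩ := (isCompact_closedBall x₀ δ).exists_bound_of_continuousOn hdc
  -- The primitive is the integral of `g` along the segment from `x₀` to `x`, which makes sense over
  -- `ℝ` and `ℂ` alike.
  let c : 𝕜 → ℝ → 𝕜 := fun x s => x₀ + (s : 𝕜) * (x - x₀)
  have hc : ∀ x ∈ Metric.ball x₀ δ, ∀ s ∈ Set.Icc (0 : ℝ) 1, c x s ∈ Metric.closedBall x₀ δ := by
    intro x hx s hs
    rw [mem_ball_iff_norm] at hx
    rw [mem_closedBall_iff_norm]
    have : ‖c x s - x₀‖ = s * ‖x - x₀‖ := by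
      simp [c, abs_of_nonneg hs.1]
    rw [this]
    nlinarith [hs.1, hs.2, norm_nonneg (x - x₀)]
  have hcc : ∀ x, Continuous (c x) := fun x => by fun_prop
  have hI : Set.uIoc (0 : ℝ) 1 ⊆ Set.Icc 0 1 := by
    rw [Set.uIoc_of_le zero_le_one]; exact Set.Ioc_subset_Icc_self
  let F : 𝕜 → ℝ → 𝕜 := fun x s => (x - x₀) * g (c x s)
  -- This is the `x`-derivative of the integrand `F x s`, and at the same time the `s`-derivative of
  -- `s * g (c x s)`. Its integral over `[0, 1]` is therefore `g x`.
  let F' : 𝕜 → ℝ → 𝕜 := fun x s => g (c x s) + (x - x₀) * (deriv g (c x s) * s)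
  have hFc : ∀ x ∈ Metric.ball x₀ δ, ContinuousOn (F x) (Set.Icc 0 1) := fun x hx =>
    continuousOn_const.mul (hgc.comp (hcc x).continuousOn (hc x hx))
  have hF'c : ∀ x ∈ Metric.ball x₀ δ, ContinuousOn (F' x) (Set.Icc 0 1) := fun x hx =>
    (hgc.comp (hcc x).continuousOn (hc x hx)).add (continuousOn_const.mul
      ((hdc.comp (hcc x).continuousOn (hc x hx)).mul RCLike.continuous_ofReal.continuousOn))
  have hF'int : ∀ x ∈ Metric.ball x₀ δ, IntervalIntegrable (F' x) MeasureTheory.volume 0 1 :=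
    fun x hx => (by rw [Set.uIcc_of_le zero_le_one]; exact hF'c x hx :
      ContinuousOn (F' x) (Set.uIcc 0 1)).intervalIntegrable
  refine ⟨fun x => ∫ s in (0 : ℝ)..1, F x s, ?_⟩
  filter_upwards [Metric.ball_mem_nhds x₀ hδ] with x hx
  have hmain := (intervalIntegral.hasDerivAt_integral_of_dominated_loc_of_deriv_le
    (μ := MeasureTheory.volume) (F := F) (F' := F') (bound := fun _ => C + δ * D)
    (a := 0) (b := 1) (x₀ := x)
    (Metric.isOpen_ball.mem_nhds hx) ?_ ?_ ?_ ?_ ?_ ?_).2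
  · have hev : ∫ s in (0 : ℝ)..1, F' x s = g x := by
      have := intervalIntegral.integral_eq_sub_of_hasDerivAt (a := 0) (b := 1)
        (f := fun s : ℝ => (s : 𝕜) * g (c x s)) (f' := F' x) ?_ (hF'int x hx)
      · rw [this]; simp [c]
      · intro s hs
        rw [Set.uIcc_of_le zero_le_one] at hs
        have h0 : HasDerivAt (fun s : ℝ => (s : 𝕜)) 1 s := by
          simpa using (RCLike.ofRealCLM (K := 𝕜)).hasDerivAt (x := s)
        have h1 : HasDerivAt (c x) (x - x₀) s := by
          exact ((h0.mul_const (x - x₀)).const_add x₀).congr_deriv (one_mul _)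
        have h2 := HasDerivAt.scomp s (hgd _ (hc x hx s hs)) h1
        refine (h0.mul h2).congr_deriv ?_
        change 1 * g (c x s) + (s : 𝕜) * ((x - x₀) * deriv g (c x s)) = F' x s
        simp only [F']
        ring
    rwa [hev] at hmain
  · filter_upwards [Metric.isOpen_ball.mem_nhds hx] with y hy
    exact ((hFc y hy).mono hI).aestronglyMeasurable measurableSet_uIoc
  · exact (by rw [Set.uIcc_of_le zero_le_one]; exact hFc x hx :
      ContinuousOn (F x) (Set.uIcc 0 1)).intervalIntegrable
  · exact ((hF'c x hx).mono hI).aestronglyMeasurable measurableSet_uIoc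
  · refine Eventually.of_forall fun s hs y hy => ?_
    have hcs := hc y hy s (hI hs)
    have hs1 : ‖(s : 𝕜)‖ ≤ 1 := by
      rw [RCLike.norm_ofReal, abs_of_nonneg (hI hs).1]; exact (hI hs).2
    have hy' : ‖y - x₀‖ ≤ δ := (mem_ball_iff_norm.1 hy).le
    calc ‖F' y s‖ ≤ ‖g (c y s)‖ + ‖y - x₀‖ * (‖deriv g (c y s)‖ * ‖(s : 𝕜)‖) := by
          refine (norm_add_le _ _).trans_eq ?_
          rw [norm_mul, norm_mul]
      _ ≤ C + δ * (D * 1) := by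
          gcongr
          · exact hC _ hcs
          · exact (norm_nonneg _).trans (hD _ hcs)
          · exact hD _ hcs
      _ = C + δ * D := by ring
  · exact intervalIntegrable_const
  · refine Eventually.of_forall fun s hs y hy => ?_
    have h1 : HasDerivAt (fun y => c y s) (s : 𝕜) y := by
      exact ((((hasDerivAt_id y).sub_const x₀).const_mul (s : 𝕜)).const_add x₀).congr_deriv
        (mul_one _)
    have h2 := ((hasDerivAt_id y).sub_const x₀).mul
      ((hgd _ (hc y hy s (hI hs))).comp y h1)
    refine h2.congr_deriv ?_
    change 1 * g (c y s) + (y - x₀) * (deriv g (c y s) * s) = F' y s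
    simp only [F', one_mul]

theorem smoothGerm_of_hasDerivAt {f g : 𝕜 → F} {x : 𝕜} (hg : SmoothGerm 𝕜 g x)
    (h : ∀ᶠ t in 𝓝 x, HasDerivAt f (g t) t) : SmoothGerm 𝕜 f x := by
  obtain ⟨V, hV, hVo, hx⟩ := eventually_nhds_iff.1 (h.and hg)
  have : ContDiffOn 𝕜 ∞ f V := by
    rw [contDiffOn_infty_iff_deriv_of_isOpen hVo]
    refine ⟨fun t ht => (hV t ht).1.differentiableAt.differentiableWithinAt, ?_⟩
    intro t ht
    refine ContDiffWithinAt.congr (f := g) (hV t ht).2.contDiffWithinAt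
      (fun y hy => (hV y hy).1.deriv) (hV t ht).1.deriv
  exact this.smoothGerm hVo hx

end Calculus

/-! ### Point transformations acting on graphs, and their linearization along a solution. -/

section Linearization

variable {𝕜 : Type*} [RCLike 𝕜] {n m : ℕ}

namespace PointTransformation

theorem smoothGerm_map (Φ : PointTransformation 𝕜 m) {p : 𝕜 × (Fin m → 𝕜)}
    (hp : p ∈ Φ.map.source) : SmoothGerm 𝕜 Φ.map p :=
  Φ.smooth_map.smoothGerm Φ.map.open_source hp

/-- The inverse point transformation. -/
def symm (Φ : PointTransformation 𝕜 m) : PointTransformation 𝕜 m where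
  map := Φ.map.symm
  smooth_map := Φ.smooth_symm
  smooth_symm := Φ.smooth_map

namespace CarriesGraph

variable {Φ : PointTransformation 𝕜 m} {y w : 𝕜 → Fin m → 𝕜} {x : 𝕜}

theorem mem_source (h : Φ.CarriesGraph y w x) : (x, y x) ∈ Φ.map.source := h.1

theorem smoothGerm_left (h : Φ.CarriesGraph y w x) : SmoothGerm 𝕜 y x :=
  smoothNear_iff_smoothGerm.1 h.2.1

theorem smoothGerm_right (h : Φ.CarriesGraph y w x) : SmoothGerm 𝕜 w (Φ.map (x, y x)).1 :=
  smoothNear_iff_smoothGerm.1 h.2.2.1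

theorem deriv_ne_zero (h : Φ.CarriesGraph y w x) :
    deriv (fun t => (Φ.map (t, y t)).1) x ≠ 0 := h.2.2.2.1

theorem eventually_snd (h : Φ.CarriesGraph y w x) :
    ∀ᶠ t in 𝓝 x, (Φ.map (t, y t)).2 = w (Φ.map (t, y t)).1 := h.2.2.2.2

theorem smoothGerm_curve (h : Φ.CarriesGraph y w x) :
    SmoothGerm 𝕜 (fun t => Φ.map (t, y t)) x :=
  SmoothGerm.comp (f := fun t => (t, y t)) (Φ.smoothGerm_map h.mem_source)
    (SmoothGerm.id.prodMk h.smoothGerm_left)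

/-- Since `z = z(t)` is a local diffeomorphism, statements holding near `x` and statements holding
near the image point can be exchanged in both directions. -/
theorem map_nhds (h : Φ.CarriesGraph y w x) :
    Filter.map (fun t => (Φ.map (t, y t)).1) (𝓝 x) = 𝓝 (Φ.map (x, y x)).1 :=
  map_nhds_of_deriv_ne_zero h.smoothGerm_curve.fst h.deriv_ne_zero

theorem apply_eq (h : Φ.CarriesGraph y w x) :
    Φ.map (x, y x) = ((Φ.map (x, y x)).1, w (Φ.map (x, y x)).1) :=
  Prod.ext rfl h.eventually_snd.self_of_nhds

/-- Every clause of the definition is an open condition on the base point. -/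
theorem eventually (h : Φ.CarriesGraph y w x) : ∀ᶠ t in 𝓝 x, Φ.CarriesGraph y w t := by
  have hc : ContinuousAt (fun t => (t, y t)) x :=
    continuousAt_id.prodMk h.smoothGerm_left.continuousAt
  filter_upwards [hc.eventually (Φ.map.open_source.mem_nhds h.mem_source),
    h.smoothGerm_left.eventually,
    h.smoothGerm_curve.fst.continuousAt.eventually h.smoothGerm_right.eventually,
    h.smoothGerm_curve.fst.deriv.continuousAt.eventually_ne h.deriv_ne_zero,
    h.eventually_snd.eventually_nhds] with t h1 h2 h3 h4 h5
  exact ⟨h1, smoothNear_iff_smoothGerm.2 h2, smoothNear_iff_smoothGerm.2 h3, h4, h5⟩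

/-- If `Φ` carries the graph of `y` to the graph of `w`, its inverse carries it back. -/
theorem symm (h : Φ.CarriesGraph y w x) : Φ.symm.CarriesGraph w y (Φ.map (x, y x)).1 := by
  set z := (Φ.map (x, y x)).1 with hz
  have hpt : Φ.symm.map (z, w z) = (x, y x) := by
    rw [← h.apply_eq]; exact Φ.map.left_inv h.mem_source
  have hsrc : (z, w z) ∈ Φ.symm.map.source := by
    rw [← h.apply_eq]; exact Φ.map.map_source h.mem_source
  have hback : ∀ᶠ t in 𝓝 x, Φ.symm.map ((Φ.map (t, y t)).1, w (Φ.map (t, y t)).1) = (t, y t) := by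
    filter_upwards [h.eventually] with t ht
    rw [← ht.apply_eq]; exact Φ.map.left_inv ht.mem_source
  have hsm : SmoothGerm 𝕜 (fun s => Φ.symm.map (s, w s)) z :=
    SmoothGerm.comp (f := fun s => (s, w s)) (Φ.symm.smoothGerm_map hsrc)
      (SmoothGerm.id.prodMk h.smoothGerm_right)
  refine ⟨hsrc, h.2.2.1, ?_, ?_, ?_⟩
  · rw [hpt]; exact h.2.1
  -- Going forward and back is the identity on the base near `x`, so a zero derivative here would
  -- give the identity derivative zero by the chain rule.
  · intro h0
    have h1 : HasDerivAt (fun s => (Φ.symm.map (s, w s)).1) 0 z := by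
      rw [← h0]; exact hsm.fst.differentiableAt.hasDerivAt
    have h2 := HasDerivAt.comp x h1 h.smoothGerm_curve.fst.differentiableAt.hasDerivAt
    have h3 : HasDerivAt (fun t : 𝕜 => t) (0 * deriv (fun t => (Φ.map (t, y t)).1) x) x := by
      refine h2.congr_of_eventuallyEq ?_
      filter_upwards [hback] with t ht
      simp only [Function.comp_apply, ht]
    have := h3.unique (hasDerivAt_id x)
    simp at this
  · rw [← h.map_nhds, eventually_map]
    filter_upwards [hback] with t ht
    rw [ht]

theorem symm_apply (h : Φ.CarriesGraph y w x) :
    Φ.symm.map ((Φ.map (x, y x)).1, w (Φ.map (x, y x)).1) = (x, y x) := by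
  rw [← h.apply_eq]; exact Φ.map.left_inv h.mem_source

end CarriesGraph

/-- Transport of a smooth one-parameter family of graphs. -/
theorem exists_carriesGraph_family (Φ : PointTransformation 𝕜 m) {u : 𝕜 × 𝕜 → Fin m → 𝕜} {x : 𝕜}
    (hu : SmoothGerm 𝕜 u (x, 0)) (hs : (x, u (x, 0)) ∈ Φ.map.source)
    (hd : deriv (fun t => (Φ.map (t, u (t, 0))).1) x ≠ 0) :
    ∃ w : 𝕜 × 𝕜 → Fin m → 𝕜, SmoothGerm 𝕜 w ((Φ.map (x, u (x, 0))).1, 0) ∧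
      Filter.map (fun p : 𝕜 × 𝕜 => ((Φ.map (p.1, u p)).1, p.2)) (𝓝 (x, 0))
        = 𝓝 ((Φ.map (x, u (x, 0))).1, 0) ∧
      ∀ᶠ p in 𝓝 (x, (0 : 𝕜)),
        Φ.CarriesGraph (fun s => u (s, p.2)) (fun z => w (z, p.2)) p.1 := by
  have hcurve : SmoothGerm 𝕜 (fun p : 𝕜 × 𝕜 => Φ.map (p.1, u p)) (x, 0) :=
    SmoothGerm.comp (f := fun p : 𝕜 × 𝕜 => (p.1, u p)) (Φ.smoothGerm_map hs)
      (SmoothGerm.id.fst.prodMk hu)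
  set a : 𝕜 × 𝕜 → 𝕜 := fun p => (Φ.map (p.1, u p)).1 with ha
  have hsa : SmoothGerm 𝕜 a (x, 0) := hcurve.fst
  have hpa : partialFst a (x, 0) ≠ 0 := by
    rwa [← (hasDerivAt_slice_fst hsa.differentiableAt).deriv]
  -- Replacing `x` by the new independent variable while keeping the parameter gives a local
  -- diffeomorphism of the plane: its derivative is triangular with diagonal `partialFst a` and `1`.
  set H : 𝕜 × 𝕜 → 𝕜 × 𝕜 := fun p => (a p, p.2) with hH
  have hsH : SmoothGerm 𝕜 H (x, 0) := hsa.prodMk SmoothGerm.id.snd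
  have hHd : HasFDerivAt H ((fderiv 𝕜 a (x, 0)).prod (ContinuousLinearMap.snd 𝕜 𝕜 𝕜)) (x, 0) :=
    hsa.differentiableAt.hasFDerivAt.prodMk hasFDerivAt_snd
  set L := (fderiv 𝕜 a (x, 0)).prod (ContinuousLinearMap.snd 𝕜 𝕜 𝕜)
  have hLinj : Function.Injective (L : (𝕜 × 𝕜) →ₗ[𝕜] 𝕜 × 𝕜) := by
    rw [injective_iff_map_eq_zero]
    rintro ⟨v1, v2⟩ hv
    have hv2 : v2 = 0 := congrArg Prod.snd hv
    have hv1 : fderiv 𝕜 a (x, 0) (v1, v2) = 0 := congrArg Prod.fst hv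
    have e : ((v1, v2) : 𝕜 × 𝕜) = v1 • (1, 0) := by simp [hv2]
    rw [e, map_smul, smul_eq_zero] at hv1
    rcases hv1 with h | h
    · simp [h, hv2]
    · exact absurd h hpa
  let L' : (𝕜 × 𝕜) ≃L[𝕜] 𝕜 × 𝕜 :=
    (LinearEquiv.ofInjectiveEndo (L : (𝕜 × 𝕜) →ₗ[𝕜] 𝕜 × 𝕜) hLinj).toContinuousLinearEquiv
  have hL' : (L' : (𝕜 × 𝕜) →L[𝕜] 𝕜 × 𝕜) = L := by
    apply ContinuousLinearMap.ext
    intro v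
    rfl
  obtain ⟨e, hxe, -, heq, -, he2⟩ :=
    exists_smooth_local_inverse hsH (g' := L') (by rw [hL']; exact hHd) univ_mem
  have hexe : e (x, 0) = (a (x, 0), 0) := heq _
  have hsymm : e.symm (a (x, 0), 0) = (x, 0) := by rw [← hexe]; exact e.left_inv hxe
  have hesm : SmoothGerm 𝕜 e.symm (a (x, 0), 0) :=
    he2.smoothGerm e.open_target (by rw [← hexe]; exact e.map_source hxe)
  have hw : SmoothGerm 𝕜 (fun q => (Φ.map ((e.symm q).1, u (e.symm q))).2) (a (x, 0), 0) :=
    (SmoothGerm.comp (h := fun p : 𝕜 × 𝕜 => Φ.map (p.1, u p)) (by rw [hsymm]; exact hcurve)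
      hesm).snd
  -- Over `(z, ε)` the value of the new graph is read off by locating, through `e.symm`, the point
  -- of the graph of `u (·, ε)` whose image lies above `z`.
  refine ⟨fun q => (Φ.map ((e.symm q).1, u (e.symm q))).2, hw, ?_, ?_⟩
  · have := e.map_nhds_eq hxe
    rw [hexe] at this
    rw [← this]
    congr 1
    funext p
    exact (heq p).symm
  · have hc1 : ContinuousAt (fun p : 𝕜 × 𝕜 => (p.1, u p)) (x, 0) :=
      continuousAt_fst.prodMk hu.continuousAt
    filter_upwards [hc1.eventually (Φ.map.open_source.mem_nhds hs), hu.eventually, hsa.eventually,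
      hsH.continuousAt.eventually hw.eventually, hsa.partialFst.continuousAt.eventually_ne hpa,
      e.open_source.mem_nhds hxe] with p h1 h2 h3 h4 h5 h6
    refine ⟨h1, smoothNear_iff_smoothGerm.2 h2.slice, smoothNear_iff_smoothGerm.2 h4.slice, ?_, ?_⟩
    · rw [← (hasDerivAt_slice_fst h3.differentiableAt).deriv] at h5
      exact h5
    · have hc : ContinuousAt (fun t : 𝕜 => (t, p.2)) p.1 := by fun_prop
      filter_upwards [hc.eventually (e.open_source.mem_nhds h6)] with t ht
      have : e.symm (a (t, p.2), p.2) = (t, p.2) := by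
        have h := e.left_inv ht
        rwa [heq] at h
      change _ = (Φ.map ((e.symm (a (t, p.2), p.2)).1, u (e.symm (a (t, p.2), p.2)))).2
      rw [this]

/-- The linearization of `Φ` along the graph of `y`, transversally to the graph of `w`. -/
noncomputable def variation (Φ : PointTransformation 𝕜 m) (y w : 𝕜 → Fin m → 𝕜) (t : 𝕜) :
    (Fin m → 𝕜) →L[𝕜] Fin m → 𝕜 :=
  let A := (fderiv 𝕜 Φ.map (t, y t)).comp (ContinuousLinearMap.inr 𝕜 𝕜 (Fin m → 𝕜))
  (ContinuousLinearMap.snd 𝕜 𝕜 (Fin m → 𝕜)).comp A -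
    ((ContinuousLinearMap.fst 𝕜 𝕜 (Fin m → 𝕜)).comp A).smulRight (deriv w (Φ.map (t, y t)).1)

theorem variation_apply (Φ : PointTransformation 𝕜 m) (y w : 𝕜 → Fin m → 𝕜) (t : 𝕜)
    (v : Fin m → 𝕜) :
    Φ.variation y w t v = (fderiv 𝕜 Φ.map (t, y t) (0, v)).2 -
      (fderiv 𝕜 Φ.map (t, y t) (0, v)).1 • deriv w (Φ.map (t, y t)).1 := by
  simp [variation]

theorem CarriesGraph.smoothGerm_variation_apply {Φ : PointTransformation 𝕜 m}
    {y w : 𝕜 → Fin m → 𝕜} {x : 𝕜} (h : Φ.CarriesGraph y w x) (v : Fin m → 𝕜) :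
    SmoothGerm 𝕜 (fun t => Φ.variation y w t v) x := by
  have h1 : SmoothGerm 𝕜 (fun t => fderiv 𝕜 Φ.map (t, y t) (0, v)) x :=
    (SmoothGerm.comp (f := fun t => (t, y t)) (Φ.smoothGerm_map h.mem_source).fderiv
      (SmoothGerm.id.prodMk h.smoothGerm_left)).clm_apply SmoothGerm.const
  have h2 : SmoothGerm 𝕜 (fun t => deriv w (Φ.map (t, y t)).1) x :=
    SmoothGerm.comp (f := fun t => (Φ.map (t, y t)).1) h.smoothGerm_right.deriv
      h.smoothGerm_curve.fst
  have h3 := h1.fst.smul h2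
  filter_upwards [h1.snd, h3] with t ht1 ht3
  simp only [variation_apply]
  exact ht1.sub ht3

theorem CarriesGraph.hasDerivAt_curve {Φ : PointTransformation 𝕜 m}
    {y w : 𝕜 → Fin m → 𝕜} {x : 𝕜} (h : Φ.CarriesGraph y w x) :
    HasDerivAt (fun t => Φ.map (t, y t)) (fderiv 𝕜 Φ.map (x, y x) (1, deriv y x)) x :=
  HasFDerivAt.comp_hasDerivAt (f := fun t => (t, y t)) x
    (Φ.smoothGerm_map h.mem_source).differentiableAt.hasFDerivAt
    ((hasDerivAt_id x).prodMk h.smoothGerm_left.differentiableAt.hasDerivAt)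

theorem fderiv_map_injective (Φ : PointTransformation 𝕜 m) {p : 𝕜 × (Fin m → 𝕜)}
    (hp : p ∈ Φ.map.source) : Function.Injective (fderiv 𝕜 Φ.map p) := by
  have h1 := (Φ.smoothGerm_map hp).differentiableAt.hasFDerivAt
  have h2 := (Φ.symm.smoothGerm_map (Φ.map.map_source hp)).differentiableAt.hasFDerivAt
  have h3 := (h2.comp p h1).congr_of_eventuallyEq (f₁ := fun q => q) (by
    filter_upwards [Φ.map.open_source.mem_nhds hp] with q hq
    exact (Φ.map.left_inv hq).symm)
  have h4 := h3.unique (hasFDerivAt_id p)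
  intro v w hvw
  have hv := DFunLike.congr_fun h4 v
  have hw := DFunLike.congr_fun h4 w
  simp only [ContinuousLinearMap.comp_apply] at hv hw
  rw [hvw] at hv
  exact hv.symm.trans hw

/-- If the variation of `v` vanishes, the differential sends `(0, v)` to a multiple `c` of the
tangent to the graph of `w`, which is the image of `(1, y')`. Injectivity gives `(0, v) = c • (1,
y')`; the first coordinate forces `c = 0`, hence `v = 0`. -/
theorem CarriesGraph.variation_injective {Φ : PointTransformation 𝕜 m}
    {y w : 𝕜 → Fin m → 𝕜} {x : 𝕜} (h : Φ.CarriesGraph y w x) :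
    Function.Injective (Φ.variation y w x) := by
  rw [injective_iff_map_eq_zero]
  intro v hv
  rw [variation_apply, sub_eq_zero] at hv
  set D := fderiv 𝕜 Φ.map (x, y x) with hD
  have hcd := h.hasDerivAt_curve
  have hz : HasDerivAt (fun t => (Φ.map (t, y t)).1) (D (1, deriv y x)).1 x := hcd.fst
  have hne : (D (1, deriv y x)).1 ≠ 0 := by
    have := h.deriv_ne_zero
    rwa [hz.deriv] at this
  have h2 : (D (1, deriv y x)).2 = (D (1, deriv y x)).1 • deriv w (Φ.map (x, y x)).1 := by
    have e1 : HasDerivAt (fun t => (Φ.map (t, y t)).2) (D (1, deriv y x)).2 x := hcd.snd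
    have e2 := HasDerivAt.scomp x h.smoothGerm_right.differentiableAt.hasDerivAt hz
    exact e1.unique (e2.congr_of_eventuallyEq h.eventually_snd)
  set c := (D (0, v)).1 / (D (1, deriv y x)).1 with hc
  have h3 : D (0, v) = D (c • (1, deriv y x)) := by
    have e1 : (D (0, v)).1 = c * (D (1, deriv y x)).1 := by rw [hc]; field_simp
    rw [map_smul]
    refine Prod.ext e1 ?_
    rw [hv, Prod.smul_snd, h2, smul_smul, e1]
  have h4 := Φ.fderiv_map_injective h.mem_source h3
  have hc0 : c = 0 := by simpa using (congrArg Prod.fst h4).symm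
  have := congrArg Prod.snd h4
  simpa [hc0] using this

/-- Differentiating a one-parameter family of transformed graphs with respect to the parameter. -/
theorem CarriesGraph.variation_partialSnd {Φ : PointTransformation 𝕜 m}
    {y w : 𝕜 → Fin m → 𝕜} {x : 𝕜} (h : Φ.CarriesGraph y w x) {u v : 𝕜 × 𝕜 → Fin m → 𝕜}
    (hu : SmoothGerm 𝕜 u (x, 0)) (hv : SmoothGerm 𝕜 v ((Φ.map (x, y x)).1, 0))
    (hu0 : ∀ᶠ t in 𝓝 x, u (t, 0) = y t)
    (hv0 : ∀ᶠ z in 𝓝 (Φ.map (x, y x)).1, v (z, 0) = w z)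
    (huv : ∀ᶠ p in 𝓝 (x, (0 : 𝕜)), (Φ.map (p.1, u p)).2 = v ((Φ.map (p.1, u p)).1, p.2)) :
    ∀ᶠ t in 𝓝 x, Φ.variation y w t (partialSnd u (t, 0))
      = partialSnd v ((Φ.map (t, y t)).1, 0) := by
  have hu' : ∀ᶠ t in 𝓝 x, SmoothGerm 𝕜 u (t, 0) :=
    (Eventually.curry_nhds hu.eventually).mono fun t ht => ht.self_of_nhds
  have hv' : ∀ᶠ z in 𝓝 (Φ.map (x, y x)).1, SmoothGerm 𝕜 v (z, 0) :=
    (Eventually.curry_nhds hv.eventually).mono fun t ht => ht.self_of_nhds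
  have hcont := h.smoothGerm_curve.fst.continuousAt
  filter_upwards [h.eventually, hu', hcont.eventually hv', hu0,
    hcont.eventually hv0.eventually_nhds, Eventually.curry_nhds huv] with t h1 h2 h3 h4 h5 h6
  set z := (Φ.map (t, y t)).1 with hz
  set η := partialSnd u (t, 0) with hη
  set D := fderiv 𝕜 Φ.map (t, y t) with hD
  have d1 : HasDerivAt (fun e => (t, u (t, e))) (0, η) 0 :=
    (hasDerivAt_const (0 : 𝕜) t).prodMk (hasDerivAt_slice_snd h2.differentiableAt)
  have d2 : HasDerivAt (fun e => Φ.map (t, u (t, e))) (D (0, η)) 0 :=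
    HasFDerivAt.comp_hasDerivAt (f := fun e : 𝕜 => (t, u (t, e))) (0 : 𝕜)
      (by rw [h4]; exact (Φ.smoothGerm_map h1.mem_source).differentiableAt.hasFDerivAt) d1
  have d3 : HasDerivAt (fun e => v ((Φ.map (t, u (t, e))).1, e))
      (fderiv 𝕜 v (z, 0) ((D (0, η)).1, 1)) 0 :=
    HasFDerivAt.comp_hasDerivAt (f := fun e : 𝕜 => ((Φ.map (t, u (t, e))).1, e)) (0 : 𝕜)
      (by rw [h4]; exact h3.differentiableAt.hasFDerivAt) (d2.fst.prodMk (hasDerivAt_id (0 : 𝕜)))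
  -- Both sides of `huv` are differentiated at parameter `0` with `t` fixed. The new independent
  -- variable moves too, which produces the correction term with `deriv w` in `variation`.
  have d4 : (D (0, η)).2 = fderiv 𝕜 v (z, 0) ((D (0, η)).1, 1) :=
    HasDerivAt.unique d2.snd (d3.congr_of_eventuallyEq h6)
  have d5 : partialFst v (z, 0) = deriv w z := by
    rw [← (hasDerivAt_slice_fst h3.differentiableAt).deriv]
    exact EventuallyEq.deriv_eq h5
  have e : (((D (0, η)).1, 1) : 𝕜 × 𝕜) = (D (0, η)).1 • (1, 0) + (0, 1) := by simp
  rw [variation_apply, d4, e, map_add, map_smul, ← d5]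
  change _ • partialFst v (z, 0) + partialSnd v (z, 0) - _ = _
  rw [add_sub_cancel_left]

end PointTransformation

theorem partialSnd_add_smul {y η : 𝕜 → Fin m → 𝕜} {t : 𝕜} (hy : ContDiffAt 𝕜 ∞ y t)
    (hη : ContDiffAt 𝕜 ∞ η t) :
    partialSnd (fun p : 𝕜 × 𝕜 => y p.1 + p.2 • η p.1) (t, 0) = η t := by
  have hd : HasDerivAt (fun e : 𝕜 => y t + e • η t) (η t) 0 := by
    simpa using ((hasDerivAt_id (0 : 𝕜)).smul_const (η t)).const_add (y t)
  have hu : ContDiffAt 𝕜 ∞ (fun p : 𝕜 × 𝕜 => y p.1 + p.2 • η p.1) (t, 0) :=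
    (ContDiffAt.comp (t, 0) (g := y) (f := Prod.fst) hy contDiffAt_fst).add
      (contDiffAt_snd.smul (ContDiffAt.comp (t, 0) (g := η) (f := Prod.fst) hη contDiffAt_fst))
  exact (hasDerivAt_slice_snd (hu.differentiableAt (by simp))).unique hd

theorem canonicalForm_solvedNear_iff {y : 𝕜 → Fin m → 𝕜} {x : 𝕜} :
    (canonicalForm 𝕜 n m).SolvedNear y x ↔ ∀ᶠ t in 𝓝 x, iteratedDeriv n y t = 0 := Iff.rfl

namespace LinearSystem

variable (S : LinearSystem 𝕜 n m)

theorem solvedNear_congr {y y' : 𝕜 → Fin m → 𝕜} {x : 𝕜} (h : y =ᶠ[𝓝 x] y') :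
    S.toODE.SolvedNear y x ↔ S.toODE.SolvedNear y' x := by
  have : ∀ᶠ t in 𝓝 x, S.toODE.op y t = S.toODE.op y' t := by
    filter_upwards [h.eventuallyEq_nhds] with t ht
    simp only [LinearSystem.toODE]
    rw [ht.iteratedDeriv_eq n]
    congr 1
    exact Finset.sum_congr rfl fun k _ => by rw [ht.iteratedDeriv_eq (n - k)]
  constructor
  · intro hy; filter_upwards [this, hy] with t h1 h2; rw [← h1, h2]
  · intro hy; filter_upwards [this, hy] with t h1 h2; rw [h1, h2]

theorem iteratedDeriv_add_smul {y η : 𝕜 → Fin m → 𝕜} {t : 𝕜} (hy : ContDiffAt 𝕜 ∞ y t)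
    (hη : ContDiffAt 𝕜 ∞ η t) (c : 𝕜) (k : ℕ) :
    iteratedDeriv k (fun s => y s + c • η s) t = iteratedDeriv k y t + c • iteratedDeriv k η t := by
  have hk : (k : WithTop ℕ∞) ≤ ∞ := by exact_mod_cast le_top
  have h1 := hη.of_le hk
  rw [← iteratedDeriv_const_smul h1 c]
  exact iteratedDeriv_add (hy.of_le hk) (h1.const_smul c)

theorem solvedNear_add_smul {y η : 𝕜 → Fin m → 𝕜} {x : 𝕜} (hy : SmoothGerm 𝕜 y x)
    (hη : SmoothGerm 𝕜 η x) (hys : S.toODE.SolvedNear y x) (hηs : S.toODE.SolvedNear η x) (c : 𝕜) :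
    S.toODE.SolvedNear (fun s => y s + c • η s) x := by
  filter_upwards [hy, hη, hys, hηs] with t h1 h2 h3 h4
  simp only [LinearSystem.toODE] at h3 h4 ⊢
  simp only [iteratedDeriv_add_smul h1 h2, Matrix.mulVec_add, Matrix.mulVec_smul,
    Finset.sum_add_distrib, ← Finset.smul_sum]
  calc _ = (iteratedDeriv n y t + ∑ k ∈ Finset.Icc 1 n,
        (S.coeff k t).mulVec (iteratedDeriv (n - k) y t)) + c • (iteratedDeriv n η t +
        ∑ k ∈ Finset.Icc 1 n, (S.coeff k t).mulVec (iteratedDeriv (n - k) η t)) := by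
        rw [smul_add]; abel
    _ = 0 := by rw [h3, h4, smul_zero, add_zero]

/-- The parameter derivative of a family of solutions is a solution. -/
theorem solvedNear_partialSnd {u : 𝕜 × 𝕜 → Fin m → 𝕜} {x : 𝕜} (hu : SmoothGerm 𝕜 u (x, 0))
    (h : ∀ᶠ p in 𝓝 (x, (0 : 𝕜)), S.toODE.op (fun s => u (s, p.2)) p.1 = 0) :
    S.toODE.SolvedNear (fun s => partialSnd u (s, 0)) x := by
  -- Only the finitely many orders `0, …, n` occur in the operator, so one neighbourhood serves for
  -- all of them.
  have hall : ∀ᶠ t in 𝓝 x, ∀ k : Fin (n + 1),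
      HasDerivAt (fun e => iteratedDeriv k (fun s => u (s, e)) t)
        (iteratedDeriv k (fun s => partialSnd u (s, 0)) t) 0 :=
    eventually_all.2 fun k => hasDerivAt_iteratedDeriv_param k hu
  filter_upwards [hall, Eventually.curry_nhds h] with t h1 h2
  have h3 : HasDerivAt (fun e => S.toODE.op (fun s => u (s, e)) t)
      (S.toODE.op (fun s => partialSnd u (s, 0)) t) 0 := by
    refine (h1 (Fin.last n)).add (HasDerivAt.fun_sum fun k _ => ?_)
    have := h1 ⟨n - k, by omega⟩
    exact ((Matrix.mulVecLin (S.coeff k t)).toContinuousLinearMap.hasFDerivAt.comp_hasDerivAt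
      (0 : 𝕜) this)
  exact h3.unique ((hasDerivAt_const (0 : 𝕜) (0 : Fin m → 𝕜)).congr_of_eventuallyEq h2)

variable {S} {Φ : PointTransformation 𝕜 m} {y w : 𝕜 → Fin m → 𝕜} {x : 𝕜}

/-- By linearity `y + ε η` is a family of solutions. `Φ` carries it to a family `v (·, ε)`
annihilated by the `n`-th derivative, and `p` is the `ε`-derivative of that family at `0`. -/
theorem solvedNear_variation (hΦ : Φ.Transforms S.toODE (canonicalForm 𝕜 n m))
    (h : Φ.CarriesGraph y w x) (hy : S.toODE.SolvedNear y x) {η : 𝕜 → Fin m → 𝕜}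
    (hη : SmoothGerm 𝕜 η x) (hηs : S.toODE.SolvedNear η x) :
    ∃ p : 𝕜 → Fin m → 𝕜, (∀ᶠ z in 𝓝 (Φ.map (x, y x)).1, iteratedDeriv n p z = 0) ∧
      ∀ᶠ t in 𝓝 x, Φ.variation y w t (η t) = p (Φ.map (t, y t)).1 := by
  set u : 𝕜 × 𝕜 → Fin m → 𝕜 := fun p => y p.1 + p.2 • η p.1 with hu
  have hu0 : ∀ t, u (t, 0) = y t := fun t => by simp [hu]
  have hus : SmoothGerm 𝕜 u (x, 0) :=
    (SmoothGerm.comp (f := fun p : 𝕜 × 𝕜 => p.1) h.smoothGerm_left SmoothGerm.id.fst).add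
      (SmoothGerm.id.snd.smul (SmoothGerm.comp (f := fun p : 𝕜 × 𝕜 => p.1) hη SmoothGerm.id.fst))
  obtain ⟨v, hv, hmap, hcar⟩ := Φ.exists_carriesGraph_family hus (by rw [hu0]; exact h.mem_source)
    (by simp only [hu0]; exact h.deriv_ne_zero)
  simp only [hu0] at hv hmap
  have hv0 : ∀ᶠ z in 𝓝 (Φ.map (x, y x)).1, v (z, 0) = w z := by
    rw [← h.map_nhds, eventually_map]
    filter_upwards [(Eventually.curry_nhds hcar).mono fun t ht => ht.self_of_nhds,
      h.eventually] with t h1 h2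
    have h3 := h1.eventually_snd.self_of_nhds
    simp only [hu0] at h3
    rw [← h3, h2.eventually_snd.self_of_nhds]
  have hsol : ∀ᶠ q in 𝓝 ((Φ.map (x, y x)).1, (0 : 𝕜)),
      iteratedDeriv n (fun z => v (z, q.2)) q.1 = 0 := by
    rw [← hmap, eventually_map]
    have hfst : Tendsto (Prod.fst : 𝕜 × 𝕜 → 𝕜) (𝓝 (x, (0 : 𝕜))) (𝓝 x) := continuousAt_fst
    filter_upwards [hcar, hfst.eventually h.smoothGerm_left.eventually,
      hfst.eventually hη.eventually, hfst.eventually hy.eventually_nhds,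
      hfst.eventually hηs.eventually_nhds] with p h1 h2 h3 h4 h5
    -- The transformation property is used at every nearby base point and parameter, and the
    -- resulting local solution is evaluated at the centre of its neighbourhood.
    exact ((hΦ.2.2 _ _ _ h1).1 (S.solvedNear_add_smul h2 h3 h4 h5 p.2)).self_of_nhds
  refine ⟨fun z => partialSnd v (z, 0), ?_, ?_⟩
  · filter_upwards [hasDerivAt_iteratedDeriv_param n hv, Eventually.curry_nhds hsol] with z h1 h2
    exact h1.unique ((hasDerivAt_const (0 : 𝕜) (0 : Fin m → 𝕜)).congr_of_eventuallyEq h2)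
  · have hvar := h.variation_partialSnd hus hv (Eventually.of_forall hu0) hv0
      (hcar.mono fun p hp => hp.eventually_snd.self_of_nhds)
    filter_upwards [hvar, h.smoothGerm_left, hη] with t h1 h2 h3
    rw [← h1]
    congr 1
    exact (partialSnd_add_smul h2 h3).symm

/-- The inverse transformation is applied to the family `w + ε p` of canonical solutions. It returns
a family of solutions of (S), and `η` is its parameter derivative. -/
theorem exists_solvedNear_variation_eq (hΦ : Φ.Transforms S.toODE (canonicalForm 𝕜 n m))
    (h : Φ.CarriesGraph y w x) (hy : S.toODE.SolvedNear y x) {p : 𝕜 → Fin m → 𝕜}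
    (hp : SmoothGerm 𝕜 p (Φ.map (x, y x)).1)
    (hps : ∀ᶠ z in 𝓝 (Φ.map (x, y x)).1, iteratedDeriv n p z = 0) :
    ∃ η : 𝕜 → Fin m → 𝕜, S.toODE.SolvedNear η x ∧
      ∀ᶠ t in 𝓝 x, Φ.variation y w t (η t) = p (Φ.map (t, y t)).1 := by
  set z₀ := (Φ.map (x, y x)).1 with hz₀
  have hsym := h.symm
  rw [← hz₀] at hsym
  have hws : ∀ᶠ z in 𝓝 z₀, iteratedDeriv n w z = 0 := (hΦ.2.2 _ _ _ h).1 hy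
  set v : 𝕜 × 𝕜 → Fin m → 𝕜 := fun q => w q.1 + q.2 • p q.1 with hv
  have hv0 : ∀ z, v (z, 0) = w z := fun t => by simp [hv]
  have hvs : SmoothGerm 𝕜 v (z₀, 0) :=
    (SmoothGerm.comp (f := fun p : 𝕜 × 𝕜 => p.1) h.smoothGerm_right SmoothGerm.id.fst).add
      (SmoothGerm.id.snd.smul (SmoothGerm.comp (f := fun p : 𝕜 × 𝕜 => p.1) hp SmoothGerm.id.fst))
  obtain ⟨u, hu, hmap, hcar⟩ := Φ.symm.exists_carriesGraph_family hvs
    (by rw [hv0]; exact hsym.mem_source) (by simp only [hv0]; exact hsym.deriv_ne_zero)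
  have hx : (Φ.symm.map (z₀, w z₀)).1 = x := by rw [h.symm_apply]
  simp only [hv0, hx] at hu hmap
  have hu0 : ∀ᶠ t in 𝓝 x, u (t, 0) = y t := by
    have h1 : ∀ᶠ z in 𝓝 z₀, Φ.symm.CarriesGraph (fun s => v (s, 0)) (fun t => u (t, 0)) z :=
      (Eventually.curry_nhds hcar).mono fun t ht => ht.self_of_nhds
    have h2 := h.smoothGerm_curve.fst.continuousAt.eventually h1
    filter_upwards [h2, h.eventually] with t h3 h4
    have h5 := h3.eventually_snd.self_of_nhds
    simp only [hv0, h4.symm_apply] at h5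
    exact h5.symm
  have hboth : ∀ᶠ q in 𝓝 (x, (0 : 𝕜)), S.toODE.op (fun s => u (s, q.2)) q.1 = 0 ∧
      (Φ.map (q.1, u q)).2 = v ((Φ.map (q.1, u q)).1, q.2) := by
    rw [← hmap, eventually_map]
    have hfst : Tendsto (Prod.fst : 𝕜 × 𝕜 → 𝕜) (𝓝 (z₀, (0 : 𝕜))) (𝓝 z₀) := continuousAt_fst
    filter_upwards [hcar, hfst.eventually h.smoothGerm_right.eventually,
      hfst.eventually hp.eventually, hfst.eventually hws.eventually_nhds,
      hfst.eventually hps.eventually_nhds] with q h1 h2 h3 h4 h5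
    -- The inverse of `Φ.symm` is definitionally `Φ`.
    have h6 : Φ.CarriesGraph (fun s => u (s, q.2)) (fun z => v (z, q.2)) (Φ.symm.map (q.1, v q)).1 :=
      h1.symm
    have h7 : (Φ.map ((Φ.symm.map (q.1, v q)).1, u ((Φ.symm.map (q.1, v q)).1, q.2))).1 = q.1 :=
      congrArg Prod.fst h1.symm_apply
    refine ⟨((hΦ.2.2 _ _ _ h6).2 ?_).self_of_nhds, h6.eventually_snd.self_of_nhds⟩
    rw [h7]
    filter_upwards [h2, h3, h4, h5] with z k1 k2 k3 k4
    change iteratedDeriv n (fun s => w s + q.2 • p s) z = 0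
    rw [iteratedDeriv_add_smul k1 k2, k3, k4, smul_zero, add_zero]
  refine ⟨fun t => partialSnd u (t, 0), S.solvedNear_partialSnd hu (hboth.mono fun _ hq => hq.1),
    ?_⟩
  have hvar := h.variation_partialSnd hu hvs hu0 (Eventually.of_forall hv0)
    (hboth.mono fun _ hq => hq.2)
  filter_upwards [hvar, h.smoothGerm_curve.fst.continuousAt.eventually h.smoothGerm_right,
    h.smoothGerm_curve.fst.continuousAt.eventually hp] with t h1 h2 h3
  rw [h1]
  exact partialSnd_add_smul h2 h3

end LinearSystem

end Linearization

/-! ### Smoothness of determinants, inverses and matrix-vector products. -/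

section MatrixSmoothness

variable {𝕜 : Type*} [RCLike 𝕜] {m : ℕ}

theorem contDiffAt_matrix_det {M : 𝕜 → Matrix (Fin m) (Fin m) 𝕜} {a : 𝕜}
    (h : ∀ i j, ContDiffAt 𝕜 ∞ (fun x => M x i j) a) : ContDiffAt 𝕜 ∞ (fun x => (M x).det) a := by
  simp only [Matrix.det_apply]
  refine ContDiffAt.sum fun σ _ => ?_
  exact (contDiffAt_prod fun i _ => h (σ i) i).const_smul _

theorem contDiffAt_matrix_inv {M : 𝕜 → Matrix (Fin m) (Fin m) 𝕜} {a : 𝕜}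
    (h : ∀ i j, ContDiffAt 𝕜 ∞ (fun x => M x i j) a) (ha : IsUnit (M a)) (i j : Fin m) :
    ContDiffAt 𝕜 ∞ (fun x => (M x)⁻¹ i j) a := by
  simp only [Matrix.inv_def, Ring.inverse_eq_inv', Matrix.smul_apply, smul_eq_mul,
    Matrix.adjugate_apply]
  refine ((contDiffAt_matrix_det h).inv ((Matrix.isUnit_iff_isUnit_det _).1 ha).ne_zero).mul
    (contDiffAt_matrix_det fun k l => ?_)
  simp only [Matrix.updateRow_apply]
  split_ifs
  · exact contDiffAt_const
  · exact h k l

theorem contDiffAt_mulVec {E : Type*} [NormedAddCommGroup E] [NormedSpace 𝕜 E]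
    {M : E → Matrix (Fin m) (Fin m) 𝕜} {v : E → Fin m → 𝕜} {a : E}
    (hM : ∀ i j, ContDiffAt 𝕜 ∞ (fun x => M x i j) a) (hv : ContDiffAt 𝕜 ∞ v a) :
    ContDiffAt 𝕜 ∞ (fun x => (M x).mulVec (v x)) a := by
  rw [contDiffAt_pi]
  intro i
  simp only [Matrix.mulVec, dotProduct]
  exact ContDiffAt.sum fun j _ => (hM i j).mul (contDiffAt_pi.1 hv j)

theorem SmoothGerm.mulVec {M : 𝕜 → Matrix (Fin m) (Fin m) 𝕜} {v : 𝕜 → Fin m → 𝕜} {a : 𝕜}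
    (hM : ∀ i j, SmoothGerm 𝕜 (fun x => M x i j) a) (hv : SmoothGerm 𝕜 v a) :
    SmoothGerm 𝕜 (fun x => (M x).mulVec (v x)) a := by
  filter_upwards [eventually_all.2 fun i => eventually_all.2 (hM i), hv] with x h1 h2
  exact contDiffAt_mulVec h1 h2

end MatrixSmoothness

/-! ### Iterative operators as conjugates of `d/dz`. -/

section Iterative

variable {𝕜 : Type*} [RCLike 𝕜] {n m : ℕ}

/-- If `r f' = 1` and `r l' + s l = 0`, then the operator `r d/dx + s` is conjugate to `d/dz`
by `u = l · (p ∘ f)`. -/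
theorem SourceOperator.iterate_apply_eventuallyEq (P : SourceOperator 𝕜) {f f' l l' : 𝕜 → 𝕜} {x : 𝕜}
    (hf : ∀ᶠ t in 𝓝 x, HasDerivAt f (f' t) t ∧ P.r t * f' t = 1)
    (hl : ∀ᶠ t in 𝓝 x, HasDerivAt l (l' t) t ∧ P.r t * l' t + P.s t * l t = 0) (k : ℕ)
    {u p : 𝕜 → 𝕜} (hp : SmoothGerm 𝕜 p (f x)) (hu : u =ᶠ[𝓝 x] fun t => l t * p (f t)) :
    P.apply^[k] u =ᶠ[𝓝 x] fun t => l t * iteratedDeriv k p (f t) := by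
  induction k generalizing u p with
  | zero => simpa using hu
  | succ k ih =>
    rw [Function.iterate_succ_apply, iteratedDeriv_succ']
    -- One application of the operator to `l · (p ∘ f)` gives `l · (p' ∘ f)`: the terms containing
    -- `p` cancel by the equation for `l`, and `r f' = 1` normalizes the remaining one.
    refine ih hp.deriv ?_
    filter_upwards [hf, hl, hu.eventuallyEq_nhds,
      hf.self_of_nhds.1.continuousAt.eventually hp] with t h1 h2 h3 h4
    have h5 := (h2.1.mul ((h4.differentiableAt (by simp)).hasDerivAt.comp t h1.1))
    have h6 := h3.deriv_eq.trans h5.deriv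
    simp only [Function.comp_apply] at h6
    rw [SourceOperator.apply, h6, h3.self_of_nhds]
    linear_combination p (f t) * h2.2 + l t * deriv p (f t) * h1.2

theorem SourceOperator.solvedNear_iterativeSystem_iff (P : SourceOperator 𝕜) {f f' l l' : 𝕜 → 𝕜}
    {x : 𝕜} (hf : ∀ᶠ t in 𝓝 x, HasDerivAt f (f' t) t ∧ P.r t * f' t = 1)
    (hl : ∀ᶠ t in 𝓝 x, HasDerivAt l (l' t) t ∧ P.r t * l' t + P.s t * l t = 0)
    (hl0 : ∀ᶠ t in 𝓝 x, l t ≠ 0) (hmap : map f (𝓝 x) = 𝓝 (f x))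
    {y w : 𝕜 → Fin m → 𝕜} (hw : SmoothGerm 𝕜 w (f x)) (hy : ∀ᶠ t in 𝓝 x, y t = l t • w (f t)) :
    (P.iterativeSystem n m).SolvedNear y x ↔ (canonicalForm 𝕜 n m).SolvedNear w (f x) := by
  have h1 : ∀ᶠ t in 𝓝 x, ∀ i, (P.apply^[n] (fun t => y t i)) t
      = l t * iteratedDeriv n (fun z => w z i) (f t) :=
    eventually_all.2 fun i => P.iterate_apply_eventuallyEq hf hl n (hw.apply i)
      (hy.mono fun t ht => by simp [ht])
  have h2 : ∀ᶠ t in 𝓝 x, (P.iterativeSystem n m).op y t = l t • iteratedDeriv n w (f t) := by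
    filter_upwards [h1, hf.self_of_nhds.1.continuousAt.eventually hw.eventually] with t ht hwt
    funext i
    rw [Pi.smul_apply, iteratedDeriv_apply n hwt]
    exact ht i
  rw [canonicalForm_solvedNear_iff, ← hmap, eventually_map]
  constructor
  · intro h
    filter_upwards [h, h2, hl0] with t k1 k2 k3
    rw [k2, smul_eq_zero] at k1
    exact k1.resolve_left k3
  · intro h
    filter_upwards [h, h2] with t k1 k2
    rw [k2, k1, smul_zero]

/-- The operator `d/dx`. -/
def derivOperator (𝕜 : Type*) [RCLike 𝕜] : SourceOperator 𝕜 where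
  dom := Set.univ
  isOpen_dom := isOpen_univ
  r := fun _ => 1
  s := fun _ => 0
  smooth_r := contDiffOn_const
  smooth_s := contDiffOn_const
  r_ne_zero := fun _ _ => one_ne_zero

/-- The iterative system differentiates each component separately and the canonical form the whole
vector; smoothness makes the two agree. -/
theorem derivOperator_solvedNear_iff {w : 𝕜 → Fin m → 𝕜} {x : 𝕜} (hw : SmoothGerm 𝕜 w x) :
    ((derivOperator 𝕜).iterativeSystem n m).SolvedNear w x ↔
      (canonicalForm 𝕜 n m).SolvedNear w x :=
  (derivOperator 𝕜).solvedNear_iterativeSystem_iff (f := fun t => t) (f' := fun _ => 1)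
    (l := fun _ => 1) (l' := fun _ => 0)
    (Eventually.of_forall fun t => ⟨hasDerivAt_id t, by simp [derivOperator]⟩)
    (Eventually.of_forall fun t => ⟨hasDerivAt_const t _, by simp [derivOperator]⟩)
    (Eventually.of_forall fun _ => one_ne_zero) Filter.map_id hw
    (Eventually.of_forall fun t => by simp)

end Iterative

/-! ### Fibre-preserving transformations, linear in the dependent variables. -/

/-- A change of variables `z = e(x)`, `y = Q(x) w`, with inverse matrix `A = Q⁻¹`. -/
structure FibreChange (𝕜 : Type*) [RCLike 𝕜] (m : ℕ) where
  e : OpenPartialHomeomorph 𝕜 𝕜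
  smooth_e : ContDiffOn 𝕜 ∞ e e.source
  smooth_e_symm : ContDiffOn 𝕜 ∞ e.symm e.target
  A : 𝕜 → Matrix (Fin m) (Fin m) 𝕜
  Q : 𝕜 → Matrix (Fin m) (Fin m) 𝕜
  smooth_A : ∀ x ∈ e.source, ∀ i j, ContDiffAt 𝕜 ∞ (fun t => A t i j) x
  smooth_Q : ∀ x ∈ e.source, ∀ i j, ContDiffAt 𝕜 ∞ (fun t => Q t i j) x
  A_mul_Q : ∀ x ∈ e.source, A x * Q x = 1
  Q_mul_A : ∀ x ∈ e.source, Q x * A x = 1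

namespace FibreChange

variable {𝕜 : Type*} [RCLike 𝕜] {m : ℕ} (Θ : FibreChange 𝕜 m)

theorem Q_mulVec_A_mulVec {x : 𝕜} (hx : x ∈ Θ.e.source) (v : Fin m → 𝕜) :
    (Θ.Q x).mulVec ((Θ.A x).mulVec v) = v := by
  rw [Matrix.mulVec_mulVec, Θ.Q_mul_A x hx, Matrix.one_mulVec]

theorem A_mulVec_Q_mulVec {x : 𝕜} (hx : x ∈ Θ.e.source) (v : Fin m → 𝕜) :
    (Θ.A x).mulVec ((Θ.Q x).mulVec v) = v := by
  rw [Matrix.mulVec_mulVec, Θ.A_mul_Q x hx, Matrix.one_mulVec]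

theorem contDiffOn_map : ContDiffOn 𝕜 ∞
    (fun p : 𝕜 × (Fin m → 𝕜) => (Θ.e p.1, (Θ.A p.1).mulVec p.2)) (Θ.e.source ×ˢ Set.univ) := by
  rintro p ⟨hp, -⟩
  refine ContDiffAt.contDiffWithinAt (ContDiffAt.prodMk ?_ ?_)
  · exact ContDiffAt.comp (g := Θ.e) (f := Prod.fst) p
      (Θ.smooth_e.contDiffAt (Θ.e.open_source.mem_nhds hp)) contDiffAt_fst
  · exact contDiffAt_mulVec (fun i j => ContDiffAt.comp (g := fun t => Θ.A t i j) (f := Prod.fst) p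
      (Θ.smooth_A _ hp i j) contDiffAt_fst) contDiffAt_snd

theorem contDiffOn_symm : ContDiffOn 𝕜 ∞
    (fun p : 𝕜 × (Fin m → 𝕜) => (Θ.e.symm p.1, (Θ.Q (Θ.e.symm p.1)).mulVec p.2))
    (Θ.e.target ×ˢ Set.univ) := by
  rintro p ⟨hp, -⟩
  have h : ContDiffAt 𝕜 ∞ (fun p : 𝕜 × (Fin m → 𝕜) => Θ.e.symm p.1) p :=
    ContDiffAt.comp (g := Θ.e.symm) (f := Prod.fst) p
      (Θ.smooth_e_symm.contDiffAt (Θ.e.open_target.mem_nhds hp)) contDiffAt_fst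
  refine ContDiffAt.contDiffWithinAt (h.prodMk ?_)
  exact contDiffAt_mulVec (fun i j => ContDiffAt.comp (g := fun t => Θ.Q t i j) p
      (Θ.smooth_Q _ (Θ.e.map_target hp) i j) h) contDiffAt_snd

/-- The point transformation `(x, y) ↦ (e(x), A(x) y)`. -/
def toPointTransformation : PointTransformation 𝕜 m where
  map :=
    { toFun := fun p => (Θ.e p.1, (Θ.A p.1).mulVec p.2)
      invFun := fun p => (Θ.e.symm p.1, (Θ.Q (Θ.e.symm p.1)).mulVec p.2)
      source := Θ.e.source ×ˢ Set.univ
      target := Θ.e.target ×ˢ Set.univ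
      map_source' := fun p hp => ⟨Θ.e.map_source hp.1, trivial⟩
      map_target' := fun p hp => ⟨Θ.e.map_target hp.1, trivial⟩
      left_inv' := fun p hp => by
        simp only [Θ.e.left_inv hp.1, Θ.Q_mulVec_A_mulVec hp.1]
      right_inv' := fun p hp => by
        simp only [Θ.e.right_inv hp.1, Θ.A_mulVec_Q_mulVec (Θ.e.map_target hp.1)]
      open_source := Θ.e.open_source.prod isOpen_univ
      open_target := Θ.e.open_target.prod isOpen_univ
      continuousOn_toFun := Θ.contDiffOn_map.continuousOn
      continuousOn_invFun := Θ.contDiffOn_symm.continuousOn }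
  smooth_map := Θ.contDiffOn_map
  smooth_symm := Θ.contDiffOn_symm

theorem mem_source_iff {p : 𝕜 × (Fin m → 𝕜)} :
    p ∈ Θ.toPointTransformation.map.source ↔ p.1 ∈ Θ.e.source :=
  ⟨fun h => h.1, fun h => ⟨h, trivial⟩⟩

theorem smoothGerm_e {x : 𝕜} (hx : x ∈ Θ.e.source) : SmoothGerm 𝕜 Θ.e x :=
  Θ.smooth_e.smoothGerm Θ.e.open_source hx

theorem smoothGerm_A {x : 𝕜} (hx : x ∈ Θ.e.source) (i j : Fin m) :
    SmoothGerm 𝕜 (fun t => Θ.A t i j) x := by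
  filter_upwards [Θ.e.open_source.mem_nhds hx] with t ht
  exact Θ.smooth_A t ht i j

theorem smoothGerm_Q {x : 𝕜} (hx : x ∈ Θ.e.source) (i j : Fin m) :
    SmoothGerm 𝕜 (fun t => Θ.Q t i j) x := by
  filter_upwards [Θ.e.open_source.mem_nhds hx] with t ht
  exact Θ.smooth_Q t ht i j

theorem deriv_e_ne_zero {x : 𝕜} (hx : x ∈ Θ.e.source) : deriv Θ.e x ≠ 0 := by
  intro h0
  have h1 := (Θ.smoothGerm_e hx).differentiableAt.hasDerivAt
  have h2 := (Θ.smooth_e_symm.smoothGerm Θ.e.open_target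
    (Θ.e.map_source hx)).differentiableAt.hasDerivAt
  rw [h0] at h1
  have h3 := (h2.comp x h1).congr_of_eventuallyEq (f₁ := fun t => t) (by
    filter_upwards [Θ.e.open_source.mem_nhds hx] with t ht
    exact (Θ.e.left_inv ht).symm)
  have := h3.unique (hasDerivAt_id x)
  simp at this

/-- The regularity of the new parameter is automatic here, as it depends on `x` alone through a
diffeomorphism. -/
theorem carriesGraph_iff {y w : 𝕜 → Fin m → 𝕜} {x : 𝕜} :
    Θ.toPointTransformation.CarriesGraph y w x ↔ x ∈ Θ.e.source ∧ SmoothGerm 𝕜 y x ∧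
      SmoothGerm 𝕜 w (Θ.e x) ∧ ∀ᶠ t in 𝓝 x, (Θ.A t).mulVec (y t) = w (Θ.e t) := by
  constructor
  · intro h
    exact ⟨Θ.mem_source_iff.1 h.mem_source, h.smoothGerm_left, h.smoothGerm_right,
      h.eventually_snd⟩
  · rintro ⟨h1, h2, h3, h4⟩
    exact ⟨Θ.mem_source_iff.2 h1, smoothNear_iff_smoothGerm.2 h2, smoothNear_iff_smoothGerm.2 h3,
      Θ.deriv_e_ne_zero h1, h4⟩

end FibreChange

/-! ### Composition of a point transformation with a fibre change. -/

namespace PointTransformation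

variable {𝕜 : Type*} [RCLike 𝕜] {m : ℕ}

/-- Composition of point transformations. -/
noncomputable def trans (Φ Θ : PointTransformation 𝕜 m) : PointTransformation 𝕜 m where
  map := Φ.map.trans Θ.map
  smooth_map := by
    intro p hp
    have hp' : p ∈ Φ.map.source ∧ Φ.map p ∈ Θ.map.source := by
      simpa [OpenPartialHomeomorph.trans_source] using hp
    exact ((Θ.smoothGerm_map hp'.2).contDiffAt.comp p
      (Φ.smoothGerm_map hp'.1).contDiffAt).contDiffWithinAt
  smooth_symm := by
    intro p hp
    have hp' : p ∈ Θ.map.target ∧ Θ.map.symm p ∈ Φ.map.target := by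
      simpa [OpenPartialHomeomorph.trans_target] using hp
    exact ((Φ.symm.smoothGerm_map hp'.2).contDiffAt.comp p
      (Θ.symm.smoothGerm_map hp'.1).contDiffAt).contDiffWithinAt

theorem mem_trans_source {Φ Θ : PointTransformation 𝕜 m} {p : 𝕜 × (Fin m → 𝕜)} :
    p ∈ (Φ.trans Θ).map.source ↔ p ∈ Φ.map.source ∧ Φ.map p ∈ Θ.map.source := by
  simp [trans]

/-- A graph carried by `Φ` followed by a fibre change is carried by `Φ` to a graph. -/
theorem CarriesGraph.of_trans {Φ : PointTransformation 𝕜 m} {Θ : FibreChange 𝕜 m}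
    {y v : 𝕜 → Fin m → 𝕜} {x : 𝕜} (h : (Φ.trans Θ.toPointTransformation).CarriesGraph y v x) :
    Φ.CarriesGraph y (fun z => (Θ.Q z).mulVec (v (Θ.e z))) x ∧
      Θ.toPointTransformation.CarriesGraph (fun z => (Θ.Q z).mulVec (v (Θ.e z))) v
        (Φ.map (x, y x)).1 := by
  obtain ⟨hs, ht⟩ := mem_trans_source.1 h.mem_source
  rw [Θ.mem_source_iff] at ht
  have hv : SmoothGerm 𝕜 v (Θ.e (Φ.map (x, y x)).1) := h.smoothGerm_right
  have hw : SmoothGerm 𝕜 (fun z => (Θ.Q z).mulVec (v (Θ.e z))) (Φ.map (x, y x)).1 :=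
    SmoothGerm.mulVec (Θ.smoothGerm_Q ht) (SmoothGerm.comp hv (Θ.smoothGerm_e ht))
  have hcurve : SmoothGerm 𝕜 (fun t => Φ.map (t, y t)) x :=
    SmoothGerm.comp (f := fun t => (t, y t)) (Φ.smoothGerm_map hs)
      (SmoothGerm.id.prodMk h.smoothGerm_left)
  refine ⟨⟨hs, h.2.1, smoothNear_iff_smoothGerm.2 hw, ?_, ?_⟩, Θ.carriesGraph_iff.2
    ⟨ht, hw, hv, ?_⟩⟩
  · intro h0
    apply h.deriv_ne_zero
    have h1 := hcurve.fst.differentiableAt.hasDerivAt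
    rw [h0] at h1
    have h2 := ((Θ.smoothGerm_e ht).differentiableAt.hasDerivAt.comp x h1).deriv
    rw [mul_zero] at h2
    exact h2
  · filter_upwards [h.eventually_snd,
      hcurve.fst.continuousAt.eventually (Θ.e.open_source.mem_nhds ht)] with t h1 h2
    have h3 : (Θ.A (Φ.map (t, y t)).1).mulVec (Φ.map (t, y t)).2 = v (Θ.e (Φ.map (t, y t)).1) := h1
    rw [← h3, Θ.Q_mulVec_A_mulVec h2]
  · filter_upwards [Θ.e.open_source.mem_nhds ht] with z hz
    exact Θ.A_mulVec_Q_mulVec hz _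

theorem CarriesGraph.trans {Φ : PointTransformation 𝕜 m} {Θ : FibreChange 𝕜 m}
    {y w : 𝕜 → Fin m → 𝕜} {x : 𝕜} (h : Φ.CarriesGraph y w x)
    (hz : (Φ.map (x, y x)).1 ∈ Θ.e.source) :
    (Φ.trans Θ.toPointTransformation).CarriesGraph y
      (fun z => (Θ.A (Θ.e.symm z)).mulVec (w (Θ.e.symm z))) x := by
  refine ⟨mem_trans_source.2 ⟨h.mem_source, Θ.mem_source_iff.2 hz⟩, h.2.1,
    smoothNear_iff_smoothGerm.2 ?_, ?_, ?_⟩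
  · change SmoothGerm 𝕜 _ (Θ.e (Φ.map (x, y x)).1)
    refine SmoothGerm.comp (h := fun z => (Θ.A z).mulVec (w z)) (f := Θ.e.symm) ?_
      (Θ.smooth_e_symm.smoothGerm Θ.e.open_target (Θ.e.map_source hz))
    rw [Θ.e.left_inv hz]
    exact SmoothGerm.mulVec (Θ.smoothGerm_A hz) h.smoothGerm_right
  · have h1 := ((Θ.smoothGerm_e hz).differentiableAt.hasDerivAt.comp x
      h.smoothGerm_curve.fst.differentiableAt.hasDerivAt).deriv
    have h2 := mul_ne_zero (Θ.deriv_e_ne_zero hz) h.deriv_ne_zero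
    rw [← h1] at h2
    exact h2
  · filter_upwards [h.eventually_snd,
      h.smoothGerm_curve.fst.continuousAt.eventually (Θ.e.open_source.mem_nhds hz)] with t h1 h2
    change (Θ.A (Φ.map (t, y t)).1).mulVec (Φ.map (t, y t)).2
      = (Θ.A (Θ.e.symm (Θ.e (Φ.map (t, y t)).1))).mulVec
        (w (Θ.e.symm (Θ.e (Φ.map (t, y t)).1)))
    rw [Θ.e.left_inv h2, h1]

/-- The second factor is restricted to a fibre change because its base map does not involve the
dependent variables: if the final curve is a graph, so is the intermediate one. For a general second
factor the intermediate curve could be vertical. -/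
theorem Transforms.trans {Φ : PointTransformation 𝕜 m} {Θ : FibreChange 𝕜 m}
    {E E' E'' : ODESystem 𝕜 m} (hΦ : Φ.Transforms E E')
    (hΘ : Θ.toPointTransformation.Transforms E' E'') :
    (Φ.trans Θ.toPointTransformation).Transforms E E'' := by
  refine ⟨fun p hp => hΦ.1 p (mem_trans_source.1 hp).1, fun q hq => hΘ.2.1 q ?_, ?_⟩
  · have : q ∈ Θ.toPointTransformation.map.target ∧
        Θ.toPointTransformation.map.symm q ∈ Φ.map.target := by
      simpa [PointTransformation.trans, OpenPartialHomeomorph.trans_target] using hq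
    exact this.1
  · intro y v x h
    obtain ⟨h1, h2⟩ := h.of_trans
    exact (hΦ.2.2 _ _ _ h1).trans (hΘ.2.2 _ _ _ h2)

end PointTransformation

/-! ### Reductions between the canonical form, iterative systems and linear changes. -/

section Reduction

variable {𝕜 : Type*} [RCLike 𝕜] {n m : ℕ}

/-- The new variable is a primitive `f` of `1/r`, and the scalar factor is `l = exp(-G)` with `G` a
primitive of `s/r`, so that `r f' = 1` and `r l' + s l = 0`. -/
theorem SourceOperator.exists_fibreChange (P : SourceOperator 𝕜) (n m : ℕ) {z₀ : 𝕜}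
    (hz₀ : z₀ ∈ P.dom) :
    ∃ Θ : FibreChange 𝕜 m, z₀ ∈ Θ.e.source ∧
      Θ.toPointTransformation.Transforms (P.iterativeSystem n m) (canonicalForm 𝕜 n m) := by
  have hr : SmoothGerm 𝕜 P.r z₀ := P.smooth_r.smoothGerm P.isOpen_dom hz₀
  have hs : SmoothGerm 𝕜 P.s z₀ := P.smooth_s.smoothGerm P.isOpen_dom hz₀
  have hr0 : P.r z₀ ≠ 0 := P.r_ne_zero z₀ hz₀
  have hri : SmoothGerm 𝕜 (fun t => 1 / P.r t) z₀ := SmoothGerm.const.div hr hr0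
  obtain ⟨f, hf⟩ := exists_primitive hri
  obtain ⟨G, hG⟩ := exists_primitive (hs.div hr hr0)
  set l : 𝕜 → 𝕜 := fun t => NormedSpace.exp (-G t) with hl
  have hl0 : ∀ t, l t ≠ 0 := fun t => by
    let _ : NormedAlgebra ℚ 𝕜 := NormedAlgebra.restrictScalars ℚ ℝ 𝕜
    exact (NormedSpace.isUnit_exp (-G t)).ne_zero
  have hld : ∀ᶠ t in 𝓝 z₀, HasDerivAt l (l t * -(P.s t / P.r t)) t := by
    filter_upwards [hG] with t ht
    exact (hasDerivAt_exp (x := -G t)).comp t ht.neg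
  have hGs : SmoothGerm 𝕜 G z₀ := smoothGerm_of_hasDerivAt (hs.div hr hr0) hG
  have hls : SmoothGerm 𝕜 l z₀ := by
    filter_upwards [hGs] with t ht
    exact ContDiffAt.comp t (g := NormedSpace.exp) (NormedSpace.exp_analytic (-G t)).contDiffAt
      ht.neg
  have hfs : SmoothGerm 𝕜 f z₀ := smoothGerm_of_hasDerivAt hri hf
  obtain ⟨e, hze, heU, hef, he1, he2⟩ := exists_smooth_local_inverse hfs
    (hf.self_of_nhds.hasFDerivAt_equiv (one_div_ne_zero hr0))
    (hf.and (hld.and (hls.and (P.isOpen_dom.mem_nhds hz₀))))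
  have hone : ∀ (i j : Fin m) (c : 𝕜 → 𝕜) (x : 𝕜), ContDiffAt 𝕜 ∞ c x →
      ContDiffAt 𝕜 ∞ (fun t => (c t • (1 : Matrix (Fin m) (Fin m) 𝕜)) i j) x := by
    intro i j c x hc
    exact hc.mul (contDiffAt_const (c := (1 : Matrix (Fin m) (Fin m) 𝕜) i j))
  let Θ : FibreChange 𝕜 m :=
    { e := e
      smooth_e := he1
      smooth_e_symm := he2
      A := fun t => (l t)⁻¹ • 1
      Q := fun t => l t • 1
      smooth_A := fun x hx i j => hone i j _ x ((heU hx).2.2.1.inv (hl0 x))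
      smooth_Q := fun x hx i j => hone i j _ x (heU hx).2.2.1
      A_mul_Q := fun x _ => by simp [hl0 x]
      Q_mul_A := fun x _ => by simp [hl0 x] }
  refine ⟨Θ, hze, fun p hp => (heU (Θ.mem_source_iff.1 hp)).2.2.2, fun _ _ => trivial, ?_⟩
  intro y w x h
  obtain ⟨hx, -, hw, hyw⟩ := Θ.carriesGraph_iff.1 h
  have hU : ∀ᶠ t in 𝓝 x, t ∈ e.source := e.open_source.mem_nhds hx
  have hex : (e : 𝕜 → 𝕜) = f := funext hef
  have hwf : SmoothGerm 𝕜 w (f x) := by rw [← hex]; exact hw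
  have := P.solvedNear_iterativeSystem_iff (n := n) (f := f) (f' := fun t => 1 / P.r t) (l := l)
    (l' := fun t => l t * -(P.s t / P.r t)) (x := x) (y := y) (w := w) ?_ ?_
    (Eventually.of_forall hl0) (by rw [← hex]; exact e.map_nhds_eq hx) hwf ?_
  · rw [this, ← hex]; rfl
  · filter_upwards [hU] with t ht
    exact ⟨(heU ht).1, mul_one_div_cancel (P.r_ne_zero t (heU ht).2.2.2)⟩
  · filter_upwards [hU] with t ht
    have := P.r_ne_zero t (heU ht).2.2.2
    exact ⟨(heU ht).2.1, by field_simp; ring⟩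
  · filter_upwards [hyw] with t ht
    have h1 : (l t)⁻¹ • y t = w (f t) := by
      rw [← hex]
      simpa [Θ, Matrix.smul_mulVec] using ht
    rw [← h1, smul_inv_smul₀ (hl0 t)]

theorem ODESystem.TransformableAt.canonicalForm_of_iterative {E : ODESystem 𝕜 m} {x₀ : 𝕜}
    {P : SourceOperator 𝕜} (h : E.TransformableAt (P.iterativeSystem n m) x₀) :
    E.TransformableAt (canonicalForm 𝕜 n m) x₀ := by
  obtain ⟨Φ, hΦ, y, w, hc, hy⟩ := h
  obtain ⟨Θ, hz, hΘ⟩ := P.exists_fibreChange n m (hΦ.2.1 _ (Φ.map.map_source hc.mem_source))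
  exact ⟨Φ.trans Θ.toPointTransformation, hΦ.trans hΘ, y, _, hc.trans hz, hy⟩

theorem ODESystem.TransformableAt.derivOperator_of_canonicalForm {E : ODESystem 𝕜 m} {x₀ : 𝕜}
    (h : E.TransformableAt (canonicalForm 𝕜 n m) x₀) :
    E.TransformableAt ((derivOperator 𝕜).iterativeSystem n m) x₀ := by
  obtain ⟨Φ, hΦ, hex⟩ := h
  refine ⟨Φ, ⟨hΦ.1, fun _ _ => trivial, fun y w x hc => ?_⟩, hex⟩
  rw [hΦ.2.2 y w x hc, derivOperator_solvedNear_iff hc.smoothGerm_right]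

theorem LinearSystem.solvedNear_zero (S : LinearSystem 𝕜 n m) (x : 𝕜) :
    S.toODE.SolvedNear 0 x := by
  refine Eventually.of_forall fun t => ?_
  have h : ∀ k, iteratedDeriv k (0 : 𝕜 → Fin m → 𝕜) t = 0 := fun k => by simp
  simp [LinearSystem.toODE, h]

/-- The linear change is the fibre change with identity base map and `A = Q⁻¹`; the zero solution,
carried to zero, shows that it is not vacuous. -/
theorem LinearSystem.transformableAt_of_linearlyTransformableAt {S : LinearSystem 𝕜 n m}
    {E : ODESystem 𝕜 m} {x₀ : 𝕜} (h : S.toODE.LinearlyTransformableAt E x₀) :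
    S.toODE.TransformableAt E x₀ := by
  obtain ⟨V, Q, hV, hx₀, hVE, hVE', hQ, hQu, hiff⟩ := h
  have hQs : ∀ x ∈ V, ∀ i j, ContDiffAt 𝕜 ∞ (fun t => Q t i j) x :=
    fun x hx i j => (hQ i j).contDiffAt (hV.mem_nhds hx)
  have hdet : ∀ x ∈ V, IsUnit (Q x).det := fun x hx => (Matrix.isUnit_iff_isUnit_det _).1 (hQu x hx)
  let Θ : FibreChange 𝕜 m :=
    { e := OpenPartialHomeomorph.ofSet V hV
      smooth_e := contDiffOn_id
      smooth_e_symm := contDiffOn_id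
      A := fun t => (Q t)⁻¹
      Q := Q
      smooth_A := fun x hx i j => contDiffAt_matrix_inv (hQs x hx) (hQu x hx) i j
      smooth_Q := hQs
      A_mul_Q := fun x hx => Matrix.nonsing_inv_mul _ (hdet x hx)
      Q_mul_A := fun x hx => Matrix.mul_nonsing_inv _ (hdet x hx) }
  refine ⟨Θ.toPointTransformation, ⟨fun p hp => hVE hp.1, fun q hq => hVE' hq.1, ?_⟩, 0, 0,
    Θ.carriesGraph_iff.2 ⟨hx₀, SmoothGerm.const, SmoothGerm.const, ?_⟩, S.solvedNear_zero x₀⟩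
  · intro y w x h
    obtain ⟨hx, -, hw, hyw⟩ := Θ.carriesGraph_iff.1 h
    have hw' : SmoothGerm 𝕜 w x := hw
    have heq : y =ᶠ[𝓝 x] fun t => (Q t).mulVec (w t) := by
      filter_upwards [hyw, hV.mem_nhds hx] with t h1 h2
      have h3 : (Q t)⁻¹.mulVec (y t) = w t := h1
      rw [← h3]
      exact (Θ.Q_mulVec_A_mulVec h2 _).symm
    rw [S.solvedNear_congr heq]
    exact hiff w x hx (smoothNear_iff_smoothGerm.2 hw')
  · exact Eventually.of_forall fun t => by simp

theorem PointTransformation.CarriesGraph.isUnit_variation {Φ : PointTransformation 𝕜 m}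
    {y w : 𝕜 → Fin m → 𝕜} {x : 𝕜} (h : Φ.CarriesGraph y w x) :
    IsUnit (LinearMap.toMatrix' (Φ.variation y w x : (Fin m → 𝕜) →ₗ[𝕜] Fin m → 𝕜)) := by
  rw [← Matrix.mulVec_injective_iff_isUnit]
  intro u v huv
  simp only [LinearMap.toMatrix'_mulVec] at huv
  exact h.variation_injective huv

theorem LinearSystem.InCanonicalClassAt.exists_linearlyTransformableAt {S : LinearSystem 𝕜 n m}
    {x₀ : 𝕜} (h : S.InCanonicalClassAt x₀) :
    ∃ P : SourceOperator 𝕜, S.toODE.LinearlyTransformableAt (P.iterativeSystem n m) x₀ := by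
  obtain ⟨Φ, hΦ, y, w, hc, hy⟩ := h
  set f : 𝕜 → 𝕜 := fun t => (Φ.map (t, y t)).1 with hf
  obtain ⟨e, hxe, heU, hef, he1, he2⟩ := exists_smooth_local_inverse hc.smoothGerm_curve.fst
    (hc.smoothGerm_curve.fst.differentiableAt.hasDerivAt.hasFDerivAt_equiv hc.deriv_ne_zero)
    (hc.eventually.and hy.eventually_nhds)
  have hcar : ∀ x ∈ e.source, Φ.CarriesGraph y w x := fun x hx => (heU hx).1
  have hfs : ∀ x ∈ e.source, SmoothGerm 𝕜 f x := fun x hx => (hcar x hx).smoothGerm_curve.fst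
  have hf0 : ∀ x ∈ e.source, deriv f x ≠ 0 := fun x hx => (hcar x hx).deriv_ne_zero
  -- With `r = 1/f'` the operator is `d/dz` for `z = f(x)`; no scalar factor is needed, so `s = 0`
  -- and the conjugating function `l` below is `1`.
  let P : SourceOperator 𝕜 :=
    { dom := e.source
      isOpen_dom := e.open_source
      r := fun t => 1 / deriv f t
      s := fun _ => 0
      smooth_r := fun x hx =>
        (SmoothGerm.const.div (hfs x hx).deriv (hf0 x hx)).contDiffAt.contDiffWithinAt
      smooth_s := contDiffOn_const
      r_ne_zero := fun x hx => one_div_ne_zero (hf0 x hx) }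
  set M : 𝕜 → Matrix (Fin m) (Fin m) 𝕜 := fun t =>
    LinearMap.toMatrix' (Φ.variation y w t : (Fin m → 𝕜) →ₗ[𝕜] Fin m → 𝕜) with hM
  have hMv : ∀ t v, (M t).mulVec v = Φ.variation y w t v := fun t v =>
    LinearMap.toMatrix'_mulVec _ v
  have hMs : ∀ x ∈ e.source, ∀ i j, ContDiffAt 𝕜 ∞ (fun t => M t i j) x := by
    intro x hx i j
    have h1 := ((hcar x hx).smoothGerm_variation_apply (Pi.single j 1)).apply i
    refine h1.contDiffAt.congr_of_eventuallyEq (Eventually.of_forall fun t => ?_)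
    simp [hM, LinearMap.toMatrix'_apply]
  have hMu : ∀ x ∈ e.source, IsUnit (M x) := fun x hx => (hcar x hx).isUnit_variation
  have hdet : ∀ x ∈ e.source, IsUnit (M x).det :=
    fun x hx => (Matrix.isUnit_iff_isUnit_det _).1 (hMu x hx)
  have hQs : ∀ x ∈ e.source, ∀ i j, ContDiffAt 𝕜 ∞ (fun t => (M t)⁻¹ i j) x :=
    fun x hx i j => contDiffAt_matrix_inv (hMs x hx) (hMu x hx) i j
  refine ⟨P, e.source, fun t => (M t)⁻¹, e.open_source, hxe,
    fun x hx => hΦ.1 _ (hcar x hx).mem_source, subset_rfl,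
    fun i j x hx => (hQs x hx i j).contDiffWithinAt,
    fun x hx => (Matrix.isUnit_nonsing_inv_iff).2 (hMu x hx), ?_⟩
  intro v x hx hv
  rw [smoothNear_iff_smoothGerm] at hv
  have hU : ∀ᶠ t in 𝓝 x, t ∈ e.source := e.open_source.mem_nhds hx
  have hmap : map f (𝓝 x) = 𝓝 (f x) := (hcar x hx).map_nhds
  have hsymm : ∀ t ∈ e.source, e.symm (f t) = t := fun t ht => by
    have := e.left_inv ht
    rwa [hef] at this
  -- The unknown `v` rewritten in the variable `z = f(x)`.
  set p : 𝕜 → Fin m → 𝕜 := fun z => v (e.symm z) with hp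
  have hps : SmoothGerm 𝕜 p (f x) := by
    refine SmoothGerm.comp (h := v) (f := e.symm) (by rw [hsymm x hx]; exact hv)
      (he2.smoothGerm e.open_target ?_)
    have := e.map_source hx
    rwa [hef] at this
  have hvp : ∀ᶠ t in 𝓝 x, v t = p (f t) := by
    filter_upwards [hU] with t ht
    simp only [hp, hsymm t ht]
  have hiter : (P.iterativeSystem n m).SolvedNear v x ↔ (canonicalForm 𝕜 n m).SolvedNear p (f x) :=
    P.solvedNear_iterativeSystem_iff (f := f) (f' := deriv f) (l := fun _ => 1) (l' := fun _ => 0)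
      (hU.mono fun t ht => ⟨(hfs t ht).differentiableAt.hasDerivAt,
        one_div_mul_cancel (hf0 t ht)⟩)
      (Eventually.of_forall fun t => ⟨hasDerivAt_const t _, by simp [P]⟩)
      (Eventually.of_forall fun _ => one_ne_zero) hmap hps
      (hvp.mono fun t ht => by rw [ht, one_smul])
  rw [hiter]
  have hηs : SmoothGerm 𝕜 (fun t => (M t)⁻¹.mulVec (v t)) x :=
    SmoothGerm.mulVec (fun i j => hU.mono fun t ht => hQs t ht i j) hv
  constructor
  -- If `M⁻¹ v` solves (S), its variation is `v` itself, hence `v = q ∘ f` with `q` canonical, and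
  -- `p` agrees with `q` because `f` covers a neighbourhood.
  · intro hsol
    obtain ⟨q, hq, hqv⟩ := LinearSystem.solvedNear_variation hΦ (hcar x hx) (heU hx).2
      hηs hsol
    have hpq : p =ᶠ[𝓝 (f x)] q := by
      change ∀ᶠ z in 𝓝 (f x), p z = q z
      rw [← hmap, eventually_map]
      filter_upwards [hqv, hvp, hU] with t h1 h2 h3
      rw [← hMv, Matrix.mulVec_mulVec, Matrix.mul_nonsing_inv _ (hdet t h3),
        Matrix.one_mulVec] at h1
      rw [← h2, h1]
    filter_upwards [hq, hpq.eventuallyEq_nhds] with z h1 h2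
    exact (h2.iteratedDeriv_eq n).trans h1
  -- A solution `η` with variation `p ∘ f = v` must be `M⁻¹ v`, since `M` is invertible.
  · intro hsol
    obtain ⟨η, hη, hηv⟩ := LinearSystem.exists_solvedNear_variation_eq hΦ (hcar x hx)
      (heU hx).2 hps hsol
    refine (S.solvedNear_congr ?_).1 hη
    filter_upwards [hηv, hvp, hU] with t h1 h2 h3
    rw [h2, show p (f t) = _ from h1.symm, ← hMv, Matrix.mulVec_mulVec,
      Matrix.nonsing_inv_mul _ (hdet t h3), Matrix.one_mulVec]

end Reduction

theorem corollary2 {𝕜 : Type*} [RCLike 𝕜] (n m : ℕ) (hn : 1 ≤ n)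
    (S : LinearSystem 𝕜 n m) (x₀ : 𝕜) (hx₀ : x₀ ∈ S.dom) :
    (S.InCanonicalClassAt x₀ ↔
      ∃ P : SourceOperator 𝕜, S.toODE.TransformableAt (P.iterativeSystem n m) x₀) ∧
    (S.InCanonicalClassAt x₀ ↔
      ∃ P : SourceOperator 𝕜, S.toODE.LinearlyTransformableAt (P.iterativeSystem n m) x₀) := by
  refine ⟨⟨fun h => ⟨_, h.derivOperator_of_canonicalForm⟩, ?_⟩,
    ⟨fun h => h.exists_linearlyTransformableAt, ?_⟩⟩
  · rintro ⟨P, h⟩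
    exact h.canonicalForm_of_iterative
  · rintro ⟨P, h⟩
    exact (LinearSystem.transformableAt_of_linearlyTransformableAt h).canonicalForm_of_iterative
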